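/- Let $\Lambda$ be the ring of symmetric functions over $\mathbb{Q}$ in an infinite alphabet $X=\{x_0,x_1,\dots\}$, and $\Lambda^*$ the ring of symmetric formal power series over $\mathbb{Q}$ in an alphabet $Y$, paired by the Hall pairing $\langle m_\lambda(Y),h_\mu(X)\rangle=\delta_{\lambda\mu}$ (extended to infinite sums of the $m_\lambda$). Let $s_\lambda=\det(h_{\lambda_i+j-i})$ be the Schur functions and $c^\lambda_{\mu\nu}$ the Littlewood–Richardson coefficients, $s_\mu s_\nu=\sum_\lambda c^\lambda_{\mu\nu}s_\lambda$. Let $f\in\mathbb{Q}[[z]]$ be a delta series with compositional inverse $g$, and define $r_n,c_n$ by $$\sum_n r_n(X)z^n=\prod_{x\in X}\frac1{1-f(z)x},\qquad \sum_n c_n(X)z^n=\prod_{x\in X}\bigl(1-f(-z)x\bigr),\qquad r_n=c_n=0\ (n<0).$$ There are unique algebra maps $U_f,U_g:\Lambda\to\Lambda$ such that, for all $n$, $U_f[h_n]=[z^n]\prod_x(1-f(z)x)^{-1}$ and $U_g[h_n]=[z^n]\prod_x(1-g(z)x)^{-1}$; they are inverse to each other, and $U_g$ has a unique adjoint $U_g^*:\Lambda^*\to\Lambda^*$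 for the Hall pairing. Let $C_m$ be the column operators on $\Lambda$, defined by $\sum_m(-1)^mC_mz^m\,[p(X)]=\prod_x(1-xz)\;p(X+1/z)$, and let $C^f_m=U_f\circ C_m\circ U_g$. Then: 1. $r_n$ is the image, under the linear embedding $\mathbb{Q}[x]\to\Lambda$, $x^n/n!\mapsto h_n$, of the sequence of convolution type $p_n(x)$ associated with $f$, i.e. the sequence dual to $1,g(y),g(y)^2,\dots$ for the pairing $(y^k,p(x))=[x^k/k!]\,p(x)$; and $p_n(x+x')=\sum_kp_k(x)p_{n-k}(x')$. 2. The elements $$P_\lambda=\det(r_{\lambda_i+j-i})=U_f[s_\lambda]=C^f_{\lambda_1'}\circ C^f_{\lambda_2'}\circ\cdots\circ C^f_{\lambda_m'}[1]$$ (where $\lambda'_1\ge\dots\ge\lambda'_m>0$ are the columns of $\lambda$), over all partitions $\lambda$, form a basis of the vector space $\Lambda$ of Littlewood–Richardson type: $$P_\lambda(X+X')=\sum_{\mu,\nu}c^\lambda_{\mu\nu}P_\mu(X)P_\nu(X')\quad\text{(a finite sum)}.$$ 3. The dual basis is $Q_\lambda=U_g^*[s_\lambda]$: this is the only family in $\Lambda^*$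 with $\langle Q_\mu,P_\lambda\rangle=\delta_{\lambda\mu}$, and every element of $\Lambda^*$ is in exactly one way an infinite linear combination of the $Q_\lambda$ (with only finitely many terms contributing to each coefficient). 4. $P_\lambda$ has the dual Jacobi–Trudi form $P_\lambda=\det(c_{\lambda'_i+j-i})$, where $\lambda'$ is the conjugate of $\lambda$. -/

import Mathlib

open scoped PowerSeries Polynomial

noncomputable section

namespace SymLR

/-! ### Symmetric functions in infinitely many variables -/

/-- The ring `Λ*` of symmetric formal power series, with rational coefficients, in the countable
alphabet `x₀, x₁, x₂, …`. -/
def SymSeries : Subalgebra ℚ (MvPowerSeries ℕ ℚ) where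
  carrier := {p | ∀ σ : Equiv.Perm ℕ, MvPowerSeries.rename σ p = p}
  mul_mem' := by
    intro a b ha hb σ
    rw [map_mul, ha σ, hb σ]
  add_mem' := by
    intro a b ha hb σ
    rw [map_add, ha σ, hb σ]
  algebraMap_mem' := by
    intro r σ
    exact AlgHom.commutes _ r

theorem coeff_mapDomain_of_mem {p : MvPowerSeries ℕ ℚ} (hp : p ∈ SymSeries)
    (σ : Equiv.Perm ℕ) (d : ℕ →₀ ℕ) :
    MvPowerSeries.coeff (d.mapDomain σ) p = MvPowerSeries.coeff d p := by
  conv_lhs => rw [← hp σ]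
  have h := MvPowerSeries.coeff_embDomain_rename (R := ℚ) σ.toEmbedding p d
  rw [Finsupp.embDomain_eq_mapDomain] at h
  exact h

theorem mem_symSeries_of_coeff {p : MvPowerSeries ℕ ℚ}
    (hp : ∀ (σ : Equiv.Perm ℕ) (d : ℕ →₀ ℕ),
      MvPowerSeries.coeff (d.mapDomain σ) p = MvPowerSeries.coeff d p) : p ∈ SymSeries := by
  intro σ
  ext d
  have hd : d = (d.mapDomain σ.symm).mapDomain σ := by
    rw [← Finsupp.mapDomain_comp]
    simp
  have h := MvPowerSeries.coeff_embDomain_rename (R := ℚ) σ.toEmbedding p (d.mapDomain σ.symm)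
  rw [Finsupp.embDomain_eq_mapDomain] at h
  have h2 := hp σ (d.mapDomain σ.symm)
  rw [hd, h2]
  exact h

/-- The ring `Λ` of symmetric functions: symmetric power series of bounded degree. -/
def SymFun : Subalgebra ℚ (MvPowerSeries ℕ ℚ) where
  carrier := {p | p ∈ SymSeries ∧
    ∃ N : ℕ, ∀ d : ℕ →₀ ℕ, N < d.degree → MvPowerSeries.coeff d p = 0}
  mul_mem' := by
    rintro a b ⟨ha, M, hM⟩ ⟨hb, N, hN⟩
    refine ⟨mul_mem ha hb, M + N, fun d hd => ?_⟩
    classical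
    rw [MvPowerSeries.coeff_mul]
    refine Finset.sum_eq_zero fun x hx => ?_
    rw [Finset.HasAntidiagonal.mem_antidiagonal] at hx
    have hdeg : x.1.degree + x.2.degree = d.degree := by rw [← hx, map_add]
    by_cases h : M < x.1.degree
    · rw [hM _ h, zero_mul]
    · rw [hN _ (by omega), mul_zero]
  add_mem' := by
    rintro a b ⟨ha, M, hM⟩ ⟨hb, N, hN⟩
    refine ⟨add_mem ha hb, M + N, fun d hd => ?_⟩
    rw [map_add, hM _ (by omega), hN _ (by omega), add_zero]
  algebraMap_mem' := by
    intro r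
    refine ⟨SymSeries.algebraMap_mem r, 0, fun d hd => ?_⟩
    classical
    rw [MvPowerSeries.algebraMap_apply, MvPowerSeries.coeff_C, if_neg]
    rintro rfl
    simp at hd

theorem symFun_le_symSeries : SymFun ≤ SymSeries := fun _ hp => hp.1

/-- The inclusion of `Λ` in `Λ*`. -/
def toSeries : SymFun →ₐ[ℚ] SymSeries := Subalgebra.inclusion symFun_le_symSeries

/-- The complete symmetric function `h_n`, the sum of all monomials of degree `n`. -/
def hFn (n : ℕ) : SymFun :=
  ⟨(fun d => if d.degree = n then 1 else 0 : (ℕ →₀ ℕ) → ℚ), by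
    refine ⟨mem_symSeries_of_coeff fun σ d => ?_, n, fun d hd => ?_⟩
    · change (if (d.mapDomain σ).degree = n then (1 : ℚ) else 0) = if d.degree = n then 1 else 0
      rw [Finsupp.degree_mapDomain]
    · exact if_neg (by omega)⟩

/-- The elementary symmetric function `e_n`, the sum of all squarefree monomials of degree `n`. -/
def eFn (n : ℕ) : SymFun :=
  ⟨(fun d => open Classical in if d.degree = n ∧ ∀ i, d i ≤ 1 then 1 else 0 : (ℕ →₀ ℕ) → ℚ), by
    classical
    refine ⟨mem_symSeries_of_coeff fun σ d => ?_, n, fun d hd => ?_⟩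
    · change (if (d.mapDomain σ).degree = n ∧ ∀ i, d.mapDomain σ i ≤ 1 then (1 : ℚ) else 0)
        = if d.degree = n ∧ ∀ i, d i ≤ 1 then 1 else 0
      refine if_congr ?_ rfl rfl
      rw [Finsupp.degree_mapDomain]
      refine and_congr_right fun _ => ⟨fun H i => ?_, fun H i => ?_⟩
      · have := H (σ i)
        rwa [Finsupp.mapDomain_apply σ.injective] at this
      · obtain ⟨j, rfl⟩ := σ.surjective i
        rw [Finsupp.mapDomain_apply σ.injective]
        exact H j
    · exact if_neg fun H => by omega⟩

/-- `h_d = ∏ᵢ h_{dᵢ}` for a composition `d` (a finitely supported sequence). -/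
def hProd (d : ℕ →₀ ℕ) : SymFun := d.prod fun _ k => hFn k

/-- `p(X + X')`: the symmetric function `p` in the disjoint union of two countable alphabets. By
symmetry the choice of the bijection between `ℕ` and `ℕ ⊕ ℕ` does not matter. -/
def plethAdd (p : SymFun) : MvPowerSeries (ℕ ⊕ ℕ) ℚ :=
  MvPowerSeries.rename Equiv.natSumNatEquivNat.symm (p : MvPowerSeries ℕ ℚ)

/-- The product `p(X) q(X')` in two disjoint alphabets. -/
def outer (p q : SymFun) : MvPowerSeries (ℕ ⊕ ℕ) ℚ :=
  MvPowerSeries.rename (Function.Embedding.inl : ℕ ↪ ℕ ⊕ ℕ) (p : MvPowerSeries ℕ ℚ) *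
    MvPowerSeries.rename (Function.Embedding.inr : ℕ ↪ ℕ ⊕ ℕ) (q : MvPowerSeries ℕ ℚ)

/-! ### Determinants indexed by partitions, and Schur functions -/

/-- A sequence `a₀, a₁, …` extended by `a_k = 0` for `k < 0`. -/
def extZ {R : Type*} [Zero R] (a : ℕ → R) : ℤ → R
  | Int.ofNat n => a n
  | Int.negSucc _ => 0

/-- `det (a_{λᵢ + j - i})`, of size the length of the partition `λ`. -/
def rowDet {R : Type*} [CommRing R] (a : ℕ → R) (lam : YoungDiagram) : R :=
  (Matrix.of fun i j : Fin (lam.colLen 0) =>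
    extZ a ((lam.rowLen i : ℤ) + (j : ℤ) - (i : ℤ))).det

/-- The Schur function `s_λ = det (h_{λᵢ + j - i})`. -/
def schur (lam : YoungDiagram) : SymFun := rowDet hFn lam

/-- `c μ ν` is the (finitely supported) family `λ ↦ c^λ_{μν}` of Littlewood–Richardson
coefficients: `s_μ s_ν = ∑_λ c^λ_{μν} s_λ`. -/
def IsLRCoeff (c : YoungDiagram → YoungDiagram → YoungDiagram →₀ ℚ) : Prop :=
  ∀ mu nu, schur mu * schur nu = (c mu nu).sum fun lam a => a • schur lam

/-! ### The Hall pairing -/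

/-- `B` is the Hall pairing `⟨w(Y), p(X)⟩` of `Λ*` with `Λ`, that is `⟨m_λ, h_μ⟩ = δ_{λμ}`, extended
to all formal sums `w` of monomial symmetric functions: `⟨w, h_d⟩` is the coefficient of
`∏ᵢ yᵢ ^ dᵢ` in `w`. -/
def IsHallPairing (B : SymSeries →ₗ[ℚ] SymFun →ₗ[ℚ] ℚ) : Prop :=
  ∀ (w : SymSeries) (d : ℕ →₀ ℕ),
    B w (hProd d) = MvPowerSeries.coeff d (w : MvPowerSeries ℕ ℚ)

/-- `S : Λ* → Λ*` is the adjoint of `U : Λ → Λ` for the pairing `B`. -/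
def IsAdjoint (B : SymSeries →ₗ[ℚ] SymFun →ₗ[ℚ] ℚ) (U : SymFun →ₐ[ℚ] SymFun)
    (S : SymSeries →ₗ[ℚ] SymSeries) : Prop :=
  ∀ w p, B (S w) p = B w (U p)

open Classical in
/-- The families `Q` in `Λ*` and `P` in `Λ` are dual: `⟨Q_μ, P_λ⟩ = δ_{λμ}`. -/
def IsDualFamily (B : SymSeries →ₗ[ℚ] SymFun →ₗ[ℚ] ℚ) (Q : YoungDiagram → SymSeries)
    (P : YoungDiagram → SymFun) : Prop :=
  ∀ mu lam, B (Q mu) (P lam) = if mu = lam then 1 else 0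

/-- The family `Q` is a (Schauder) basis of `Λ*`: every symmetric series is, in exactly one way, a
formal infinite combination of the `Q λ`; coefficientwise all these sums are finite. -/
def IsSeriesBasis (Q : YoungDiagram → SymSeries) : Prop :=
  (∀ d : ℕ →₀ ℕ,
    {lam | MvPowerSeries.coeff d (Q lam : MvPowerSeries ℕ ℚ) ≠ 0}.Finite) ∧
  ∀ w : SymSeries, ∃! a : YoungDiagram → ℚ, ∀ d : ℕ →₀ ℕ,
    MvPowerSeries.coeff d (w : MvPowerSeries ℕ ℚ) =
      ∑ᶠ lam, a lam * MvPowerSeries.coeff d (Q lam : MvPowerSeries ℕ ℚ)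

/-! ### Delta series and the functions `r_n` and `c_n` -/

/-- `f` is a delta series with compositional inverse `g`: `f(g(z)) = g(f(z)) = z` (with zero
constant terms, so that the compositions make sense). -/
structure IsDeltaPair (f g : ℚ⟦X⟧) : Prop where
  constantCoeff_left : PowerSeries.constantCoeff f = 0
  constantCoeff_right : PowerSeries.constantCoeff g = 0
  subst_right : f.subst g = (PowerSeries.X : ℚ⟦X⟧)
  subst_left : g.subst f = (PowerSeries.X : ℚ⟦X⟧)

/-- For a series `φ` in `t` over `ℚ⟦z⟧` with `φ(0) = 1`, the infinite product `∏_x φ(x)` over the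
alphabet, as a power series over `ℚ⟦z⟧`: the coefficient at `∏ᵢ xᵢ ^ dᵢ` is the product of the
coefficients of `φ` at `t ^ dᵢ`. -/
def alphabetProd (φ : ℚ⟦X⟧⟦X⟧) : MvPowerSeries ℕ ℚ⟦X⟧ :=
  fun d => d.prod fun _ k => PowerSeries.coeff k φ

/-- `alphabetProd` has the same coefficients as all sufficiently large finite products of the
factors `φ(xᵢ)`. -/
theorem coeff_finite_prod (φ : ℚ⟦X⟧⟦X⟧) (hφ : PowerSeries.constantCoeff φ = 1)
    (d : ℕ →₀ ℕ) (s : Finset ℕ) (hs : d.support ⊆ s) :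
    MvPowerSeries.coeff d (∏ i ∈ s, PowerSeries.toMvPowerSeries i φ) =
      MvPowerSeries.coeff d (alphabetProd φ) := by
  classical
  have key (i k : ℕ) : MvPowerSeries.coeff (Finsupp.single i k)
      (PowerSeries.toMvPowerSeries i φ) = PowerSeries.coeff k φ := by
    have hk := MvPowerSeries.coeff_embDomain_rename (R := ℚ⟦X⟧)
      (Function.Embedding.punit i) φ (Finsupp.single () k)
    rw [Finsupp.embDomain_single] at hk
    exact hk
  have key0 (i : ℕ) (x : ℕ →₀ ℕ) (hx : ∀ k, x ≠ Finsupp.single i k) : MvPowerSeries.coeff x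
      (PowerSeries.toMvPowerSeries i φ) = 0 := by
    refine MvPowerSeries.coeff_rename_eq_zero _ _ ?_
    rintro ⟨y, rfl⟩
    refine hx (y ()) ?_
    conv_lhs => rw [Finsupp.unique_single y, Finsupp.mapDomain_single]
  rw [MvPowerSeries.coeff_prod]
  change _ = d.prod fun _ k => PowerSeries.coeff k φ
  rw [Finsupp.prod_of_support_subset d hs _ fun i _ => by
    rw [PowerSeries.coeff_zero_eq_constantCoeff_apply, hφ]]
  have hex : ∀ i ∉ s, Finsupp.single i (d i) = 0 := fun i hi => by
    rw [Finsupp.single_eq_zero]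
    exact Finsupp.notMem_support_iff.1 fun H => hi (hs H)
  let l₀ : ℕ →₀ ℕ →₀ ℕ := Finsupp.onFinset s (fun i => Finsupp.single i (d i))
    fun i hi => by_contra fun H => hi (hex i H)
  rw [Finset.sum_eq_single l₀]
  · exact Finset.prod_congr rfl fun i _ => key i (d i)
  · intro l hl hne
    rw [Finset.mem_finsuppAntidiag] at hl
    by_contra H
    have hl1 : ∀ i ∈ s, ∃ k, l i = Finsupp.single i k := fun i hi => by
      by_contra H1
      push Not at H1
      exact H (Finset.prod_eq_zero hi (key0 i _ H1))
    refine hne (Finsupp.ext fun i => ?_)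
    change l i = Finsupp.single i (d i)
    by_cases hi : i ∈ s
    · obtain ⟨k, hk⟩ := hl1 i hi
      have hd := DFunLike.congr_fun hl.1 i
      rw [Finset.sum_apply', Finset.sum_eq_single i] at hd
      · rw [hk, Finsupp.single_eq_same] at hd
        rw [hk, hd]
      · intro j hj hji
        obtain ⟨k', hk'⟩ := hl1 j hj
        rw [hk', Finsupp.single_eq_of_ne hji.symm]
      · exact fun H2 => absurd hi H2
    · rw [hex i hi]
      exact Finsupp.notMem_support_iff.1 fun H2 => hi (hl.2 H2)
  · intro H
    refine absurd (Finset.mem_finsuppAntidiag.2 ⟨?_, Finsupp.support_onFinset_subset⟩) H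
    change ∑ i ∈ s, Finsupp.single i (d i) = d
    conv_rhs => rw [← Finsupp.sum_single d]
    exact (Finsupp.sum_of_support_subset d hs _ fun i _ => Finsupp.single_zero i).symm

/-- `[z^n]` of a power series in the alphabet over `ℚ⟦z⟧`. -/
def zCoeff (n : ℕ) (F : MvPowerSeries ℕ ℚ⟦X⟧) : MvPowerSeries ℕ ℚ :=
  fun d => PowerSeries.coeff n (MvPowerSeries.coeff d F)

/-- The generalized complete functions: `∑ r_n zⁿ = ∏_x 1 / (1 - f(z) x)`. -/
def rFn (f : ℚ⟦X⟧) (n : ℕ) : MvPowerSeries ℕ ℚ :=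
  zCoeff n (alphabetProd (PowerSeries.invOfUnit (1 - PowerSeries.C f * PowerSeries.X) 1))

/-- The generalized elementary functions: `∑ c_n zⁿ = ∏_x (1 - f(-z) x)`. -/
def cFn (f : ℚ⟦X⟧) (n : ℕ) : MvPowerSeries ℕ ℚ :=
  zCoeff n (alphabetProd (1 - PowerSeries.C (PowerSeries.rescale (-1) f) * PowerSeries.X))

/-! ### Umbral operators and sequences of convolution type -/

/-- `U` is the umbral operator `U_f` on `Λ`: the algebra map with `h_n ↦ r_n` for all `n`. -/
def IsUmbral (f : ℚ⟦X⟧) (U : SymFun →ₐ[ℚ] SymFun) : Prop :=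
  ∀ n, (U (hFn n) : MvPowerSeries ℕ ℚ) = rFn f n

/-- The pairing of `ℚ[x]* = ℚ⟦y⟧` with `ℚ[x]`, in which `y ^ k` extracts the coefficient of
`x ^ k / k!`. -/
def umbralPairing (φ : ℚ⟦X⟧) (p : ℚ[X]) : ℚ :=
  p.sum fun k a => PowerSeries.coeff k φ * (k.factorial * a)

/-- `p_n(x + x') = ∑_k p_k(x) p_{n-k}(x')`, an identity in `ℚ[x'][x]`. -/
def IsConvolutionType (p : ℕ → ℚ[X]) : Prop :=
  ∀ n, Polynomial.aeval (Polynomial.X + Polynomial.C Polynomial.X : ℚ[X][X]) (p n) =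
    ∑ ij ∈ Finset.HasAntidiagonal.antidiagonal n,
      (p ij.1).map (algebraMap ℚ ℚ[X]) * Polynomial.C (p ij.2)

/-- The sequence of convolution type associated with `f`: it is dual to the powers of the
compositional inverse `g` of `f`. -/
def IsDualToPowers (g : ℚ⟦X⟧) (p : ℕ → ℚ[X]) : Prop :=
  ∀ k n, umbralPairing (g ^ k) (p n) = if k = n then 1 else 0

/-- The linear embedding `ℚ[x] → Λ` with `x ^ n / n! ↦ h_n`. -/
def polyEmbed : ℚ[X] →ₗ[ℚ] SymFun :=
  Polynomial.lsum fun n => LinearMap.toSpanSingleton ℚ SymFun ((n.factorial : ℚ) • hFn n)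

/-! ### Column operators -/

/-- `∂_{h_n} p`, the coefficient of `z ^ n` in `p(X + z)`; the latter is `p` in the alphabet
`z, x₀, x₁, …`. -/
def shiftCoeff (n : ℕ) (p : SymFun) : SymFun :=
  ⟨(fun d => MvPowerSeries.coeff (d.mapDomain Nat.succ + Finsupp.single 0 n)
      (p : MvPowerSeries ℕ ℚ) : (ℕ →₀ ℕ) → ℚ), by
    obtain ⟨p, hp, N, hN⟩ := p
    refine ⟨mem_symSeries_of_coeff fun σ d => ?_, N, fun d hd => ?_⟩
    · let τ : Equiv.Perm ℕ :=
        { toFun := fun i => Nat.casesOn i 0 fun j => (σ j).succ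
          invFun := fun i => Nat.casesOn i 0 fun j => (σ.symm j).succ
          left_inv := by rintro (_ | i) <;> simp
          right_inv := by rintro (_ | i) <;> simp }
      have hτ : (d.mapDomain σ).mapDomain Nat.succ + Finsupp.single 0 n =
          (d.mapDomain Nat.succ + Finsupp.single 0 n).mapDomain τ := by
        rw [Finsupp.mapDomain_add, Finsupp.mapDomain_single, ← Finsupp.mapDomain_comp,
          ← Finsupp.mapDomain_comp]
        rfl
      change MvPowerSeries.coeff ((d.mapDomain σ).mapDomain Nat.succ + Finsupp.single 0 n) p =
        MvPowerSeries.coeff (d.mapDomain Nat.succ + Finsupp.single 0 n) p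
      rw [hτ, coeff_mapDomain_of_mem hp]
    · refine hN _ ?_
      rw [map_add, Finsupp.degree_mapDomain]
      omega⟩

/-- The column operator `C_m`, given by `∑_m (-1)^m C_m z^m = P(-z) T(1/z)`, where
`T(1/z) p = p(X + 1/z) = ∑_n z^{-n} ∂_{h_n} p` and `P(-z)` is multiplication by
`∏_x (1 - x z) = ∑_k (-z)^k e_k`. The sum is finite since `p` has bounded degree. -/
def colOp (m : ℕ) (p : SymFun) : SymFun :=
  ∑ᶠ n : ℕ, (-1 : ℚ) ^ n • (eFn (m + n) * shiftCoeff n p)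

/-- `C^f_{λ'_1} ∘ C^f_{λ'_2} ∘ ⋯ ∘ C^f_{λ'_m} [1]`, where `C^f_m = U_f ∘ C_m ∘ U_g`. -/
def colIterate (Uf Ug : SymFun →ₐ[ℚ] SymFun) (lam : YoungDiagram) : SymFun :=
  lam.transpose.rowLens.foldr (fun m p => Uf (colOp m (Ug p))) 1

end SymLR

end

open SymLR

/-!
The theorem is the classical theory of Schur functions, transported along the automorphism `U_f` of
`Λ`. The functions `r_n = ∑_k ([z^n] f(z)^k) h_k` and `c_n` satisfy the same relation
`∑ (-1)^i c_i r_{n-i} = 0` as the `e_n` and `h_n` (`sum_cFn_mul_rFn`), so `U_f` maps `h_n` to `r_n`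
and `e_n` to `c_n`, and the substitution `f(g(z)) = z` shows that `U_f` and `U_g` are inverse to each
other (`umbral_comp_umbral`). It also commutes with the coproduct (`plethAdd_umbral`), because
`[z^n] f(z)^(a+b) = ∑_k [z^k] f(z)^a · [z^(n-k)] f(z)^b`. The claims on `P_λ = U_f[s_λ]` and
`Q_λ = U_g^*[s_λ]` then follow from those on `s_λ`. Most of the work is to establish the latter in
infinitely many variables, together with the Hall pairing.

Let `∂_n p` be the coefficient of `u^n` in `p(X + u)`; `p ↦ p(X + u)` is an algebra map
(`shiftHom`), with `h_n ↦ ∑_k u^k h_{n-k}` and `e_n ↦ e_n + u e_{n-1}`. The pairing is first defined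
between symmetric series and the polynomial ring in indeterminates `h₁, h₂, …` (`polyPairing`).
There `∂_n` is adjoint to multiplication by `h_n` on both sides, and so the pairing is symmetric
(`polyPairing_hEval_comm`).

Column operations on Jacobi–Trudi determinants show that the column operator `C_m` adds a row `m` on
top of a determinant in the `e_n` (`colOp_seqDet_eFn`), and adds `1` to all the parts of a
determinant in the `h_n` of size `m` (`colOp_seqDet_hFn`). Both `det (h_{λᵢ+j-i})` and
`det (e_{λ'ᵢ+j-i})` are therefore obtained from `1` by the column operators of the columns of `λ`,
which also gives the dual Jacobi–Trudi formula.

From the determinant in the `e_n`, `∂_m s_λ` is zero for `m > λ₁` and is `s_λ` without its first row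
for `m = λ₁`. Expanding the determinant of `s_μ` in the `h_n` along its first row, and using the
symmetry of the pairing to assume `λ₁ ≤ μ₁`, yields orthonormality by induction
(`polyPairing_schur_schurPoly`). Conversely, a nonzero symmetric function `p` is not orthogonal to
all `s_λ`: among the exponents that occur in `p` take a partition `λ` with the largest sum of
squares. All the terms but `h_λ` of the determinant `s_λ` have a larger sum of squares by the
rearrangement inequality, so that `⟨p, s_λ⟩` is the coefficient of `x^λ` in `p`
(`eq_zero_of_polyPairing_schurPoly`). Hence the `s_λ` form a basis, the `h_n` generate `Λ`, and by
symmetry of the pairing they are algebraically independent.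

Finally, the product of `Λ*` is dual to the coproduct of `Λ` (`hallPairing_mul`), so the coefficients
of `Δ s_λ` in the basis `s_μ ⊗ s_ν` are `⟨s_μ s_ν, s_λ⟩ = c^λ_{μν}` (`repr_coproduct_schur`).
-/

noncomputable section

namespace SymLR

/-! ### Compositions and their multiplicities -/

/-- The exponent of `h_n` as a monomial in `h₁, h₂, …`, with `h₀ = 1`. -/
def genExp : ℕ → ℕ →₀ ℕ
  | 0 => 0
  | n + 1 => Finsupp.single n 1

/-- The multiplicities of the parts of the composition `d`: at `k`, the number of parts equal to
`k + 1`. -/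
def partMult (d : ℕ →₀ ℕ) : ℕ →₀ ℕ := d.sum fun _ k => genExp k

/-- The composition with first part `n`, followed by the parts of `d`. -/
def consComp (n : ℕ) (d : ℕ →₀ ℕ) : ℕ →₀ ℕ := d.mapDomain Nat.succ + Finsupp.single 0 n

theorem genExp_apply (n k : ℕ) : genExp n k = if n = k + 1 then 1 else 0 := by
  cases n with
  | zero => simp [genExp]
  | succ n => simp [genExp, Finsupp.single_apply]

theorem partMult_apply (d : ℕ →₀ ℕ) (k : ℕ) :
    partMult d k = Nat.card {i // d i = k + 1} := by
  classical
  have hs : ∀ i, i ∈ d.support.filter (fun i => d i = k + 1) ↔ d i = k + 1 := by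
    intro i
    simp only [Finset.mem_filter, Finsupp.mem_support_iff, and_iff_right_iff_imp]
    omega
  rw [Nat.subtype_card _ hs, partMult, Finsupp.sum, Finsupp.finsetSum_apply, Finset.card_filter]
  exact Finset.sum_congr rfl fun i _ => genExp_apply _ _

theorem partMult_zero : partMult 0 = 0 := Finsupp.sum_zero_index

theorem consComp_zero (n : ℕ) (d : ℕ →₀ ℕ) : consComp n d 0 = n := by
  rw [consComp, Finsupp.add_apply, Finsupp.mapDomain_of_notMem_range _ _ (by simp)]
  simp

theorem consComp_succ (n : ℕ) (d : ℕ →₀ ℕ) (i : ℕ) : consComp n d (i + 1) = d i := by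
  rw [consComp, Finsupp.add_apply]
  have := Finsupp.mapDomain_apply Nat.succ_injective d i
  simp [Nat.succ_eq_add_one] at this ⊢
  exact this

theorem consComp_eta (d : ℕ →₀ ℕ) :
    consComp (d 0) (d.comapDomain Nat.succ Nat.succ_injective.injOn) = d := by
  ext i
  cases i with
  | zero => rw [consComp_zero]
  | succ i => rw [consComp_succ]; rfl

theorem consComp_inj {m n : ℕ} {d e : ℕ →₀ ℕ} (h : consComp m d = consComp n e) :
    m = n ∧ d = e := by
  refine ⟨?_, Finsupp.ext fun i => ?_⟩
  · rw [← consComp_zero m d, h, consComp_zero]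
  · rw [← consComp_succ m d, h, consComp_succ]

theorem consComp_zero_zero : consComp 0 0 = 0 := by simp [consComp]

theorem consComp_add (m n : ℕ) (d e : ℕ →₀ ℕ) :
    consComp m d + consComp n e = consComp (m + n) (d + e) := by
  ext i
  cases i with
  | zero => simp only [Finsupp.add_apply, consComp_zero]
  | succ i => simp only [Finsupp.add_apply, consComp_succ]

theorem degree_consComp (n : ℕ) (d : ℕ →₀ ℕ) : (consComp n d).degree = n + d.degree := by
  rw [consComp, map_add, Finsupp.degree_mapDomain, Finsupp.degree_single, add_comm]

theorem prod_consComp {M : Type*} [CommMonoid M] (φ : ℕ → M) (h0 : φ 0 = 1) (n : ℕ)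
    (d : ℕ →₀ ℕ) : (consComp n d).prod (fun _ => φ) = φ n * d.prod fun _ => φ := by
  classical
  rw [consComp, add_comm, Finsupp.prod_add_index_of_disjoint, Finsupp.prod_single_index h0,
    Finsupp.prod_mapDomain_index_inj Nat.succ_injective]
  rw [Finset.disjoint_left]
  intro i hi
  rw [Finsupp.mem_support_iff, Finsupp.single_apply] at hi
  have : i = 0 := by by_contra H; exact hi (if_neg (Ne.symm H))
  subst this
  rw [Finsupp.notMem_support_iff, Finsupp.mapDomain_of_notMem_range _ _ (by simp)]

theorem partMult_consComp (n : ℕ) (d : ℕ →₀ ℕ) :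
    partMult (consComp n d) = genExp n + partMult d :=
  prod_consComp (M := Multiplicative (ℕ →₀ ℕ)) (fun k => Multiplicative.ofAdd (genExp k)) rfl n d

theorem exists_partMult_eq (m : ℕ →₀ ℕ) : ∃ d, partMult d = m := by
  have key (s : Multiset ℕ) : ∃ d, partMult d = Multiset.toFinsupp s := by
    induction s using Multiset.induction_on with
    | empty => exact ⟨0, by rw [partMult_zero, map_zero]⟩
    | cons a s ih =>
      obtain ⟨d, hd⟩ := ih
      refine ⟨consComp (a + 1) d, ?_⟩
      rw [partMult_consComp, hd, ← Multiset.singleton_add, map_add, Multiset.toFinsupp_singleton]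
      rfl
  obtain ⟨d, hd⟩ := key (Finsupp.toMultiset m)
  exact ⟨d, by rw [hd, Finsupp.toMultiset_toFinsupp]⟩

/-- Compositions with the same multiplicities are rearrangements of each other. The positions of
the zero parts are matched as well, which is possible since there are infinitely many of them in
both. -/
theorem exists_perm_of_partMult_eq {d e : ℕ →₀ ℕ} (h : partMult d = partMult e) :
    ∃ σ : Equiv.Perm ℕ, d.mapDomain σ = e := by
  have hfib (c : ℕ) : Nonempty ({i // d i = c} ≃ {i // e i = c}) := by
    cases c with
    | zero =>
      have hinf (d : ℕ →₀ ℕ) : Infinite {i // d i = 0} := by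
        refine Set.infinite_coe_iff.2 ?_
        have h2 := d.support.finite_toSet.infinite_compl
        have h3 : (↑d.support : Set ℕ)ᶜ = {i | d i = 0} := by
          ext i
          simp
        rwa [h3] at h2
      have := hinf d
      have := hinf e
      exact ⟨(nonempty_equiv_of_countable).some⟩
    | succ k =>
      have hfin (d : ℕ →₀ ℕ) : Finite {i // d i = k + 1} := by
        refine (d.support.finite_toSet.subset fun i hi => ?_ : {i | d i = k + 1}.Finite)
        have hi' : d i = k + 1 := hi
        simp [hi']
      have := hfin d
      have := hfin e
      rw [← Finite.card_eq, ← partMult_apply, ← partMult_apply, h]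
  let σ : Equiv.Perm ℕ := Equiv.ofFiberEquiv (f := d) (g := e) fun c => (hfib c).some
  have hσ (i : ℕ) : e (σ i) = d i := Equiv.ofFiberEquiv_map _ i
  refine ⟨σ, Finsupp.ext fun i => ?_⟩
  obtain ⟨j, rfl⟩ := σ.surjective i
  rw [Finsupp.mapDomain_apply σ.injective, hσ]

theorem coeff_eq_of_partMult_eq {w : MvPowerSeries ℕ ℚ} (hw : w ∈ SymSeries) {d e : ℕ →₀ ℕ}
    (h : partMult d = partMult e) : MvPowerSeries.coeff d w = MvPowerSeries.coeff e w := by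
  obtain ⟨σ, rfl⟩ := exists_perm_of_partMult_eq h
  rw [coeff_mapDomain_of_mem hw]

/-! ### Products over the alphabet -/

theorem coeff_hFn (n : ℕ) (d : ℕ →₀ ℕ) :
    MvPowerSeries.coeff d (hFn n : MvPowerSeries ℕ ℚ) = if d.degree = n then 1 else 0 := rfl

open Classical in
theorem coeff_eFn (n : ℕ) (d : ℕ →₀ ℕ) : MvPowerSeries.coeff d (eFn n : MvPowerSeries ℕ ℚ) =
    if d.degree = n ∧ ∀ i, d i ≤ 1 then 1 else 0 := rfl

theorem hFn_zero : hFn 0 = 1 := by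
  classical
  refine Subtype.ext (MvPowerSeries.ext fun d => ?_)
  change MvPowerSeries.coeff d (hFn 0 : MvPowerSeries ℕ ℚ) = MvPowerSeries.coeff d 1
  simp [coeff_hFn, MvPowerSeries.coeff_one, Finsupp.degree_eq_zero_iff]

theorem eFn_zero : eFn 0 = 1 := by
  classical
  refine Subtype.ext (MvPowerSeries.ext fun d => ?_)
  change MvPowerSeries.coeff d (eFn 0 : MvPowerSeries ℕ ℚ) = MvPowerSeries.coeff d 1
  rw [coeff_eFn, MvPowerSeries.coeff_one]
  refine if_congr ?_ rfl rfl
  rw [Finsupp.degree_eq_zero_iff]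
  refine ⟨fun h => h.1, ?_⟩
  rintro rfl
  simp

theorem coeff_alphabetProd (φ : ℚ⟦X⟧⟦X⟧) (d : ℕ →₀ ℕ) :
    MvPowerSeries.coeff d (alphabetProd φ) = d.prod fun _ k => PowerSeries.coeff k φ := rfl

theorem coeff_zCoeff (n : ℕ) (F : MvPowerSeries ℕ ℚ⟦X⟧) (d : ℕ →₀ ℕ) :
    MvPowerSeries.coeff d (zCoeff n F) = PowerSeries.coeff n (MvPowerSeries.coeff d F) := rfl

theorem alphabetProd_mul (φ ψ : ℚ⟦X⟧⟦X⟧) (hφ : PowerSeries.constantCoeff φ = 1)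
    (hψ : PowerSeries.constantCoeff ψ = 1) :
    alphabetProd φ * alphabetProd ψ = alphabetProd (φ * ψ) := by
  classical
  ext1 d
  have hφψ : PowerSeries.constantCoeff (φ * ψ) = 1 := by rw [map_mul, hφ, hψ, one_mul]
  rw [← coeff_finite_prod _ hφψ d d.support subset_rfl]
  have hmul (i : ℕ) : PowerSeries.toMvPowerSeries i (φ * ψ) =
      PowerSeries.toMvPowerSeries i φ * PowerSeries.toMvPowerSeries (R := ℚ⟦X⟧) i ψ :=
    map_mul _ _ _
  simp only [hmul, Finset.prod_mul_distrib]
  rw [MvPowerSeries.coeff_mul, MvPowerSeries.coeff_mul]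
  refine Finset.sum_congr rfl fun x hx => ?_
  rw [Finset.HasAntidiagonal.mem_antidiagonal] at hx
  have h1 : x.1 ≤ d := hx ▸ le_self_add
  have h2 : x.2 ≤ d := hx ▸ le_add_self
  rw [coeff_finite_prod φ hφ _ _ (Finsupp.support_mono h1),
    coeff_finite_prod ψ hψ _ _ (Finsupp.support_mono h2)]

theorem zCoeff_mul (n : ℕ) (F G : MvPowerSeries ℕ ℚ⟦X⟧) : zCoeff n (F * G) =
    ∑ ij ∈ Finset.HasAntidiagonal.antidiagonal n, zCoeff ij.1 F * zCoeff ij.2 G := by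
  classical
  ext d
  simp only [coeff_zCoeff, MvPowerSeries.coeff_mul, map_sum, PowerSeries.coeff_mul]
  exact Finset.sum_comm

theorem alphabetProd_one : alphabetProd 1 = 1 := by
  classical
  ext1 d
  rw [coeff_alphabetProd, MvPowerSeries.coeff_one]
  split_ifs with h
  · subst h; simp
  · obtain ⟨i, hi⟩ := Finsupp.support_nonempty_iff.2 h
    refine Finset.prod_eq_zero hi ?_
    exact (PowerSeries.coeff_one _).trans (if_neg (Finsupp.mem_support_iff.1 hi))

theorem coeff_invOfUnit_one_sub (f : ℚ⟦X⟧) (k : ℕ) :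
    PowerSeries.coeff k (PowerSeries.invOfUnit (1 - PowerSeries.C f * PowerSeries.X) 1) = f ^ k := by
  have h1 : (1 - PowerSeries.C f * PowerSeries.X : ℚ⟦X⟧⟦X⟧) *
      PowerSeries.invOfUnit (1 - PowerSeries.C f * PowerSeries.X) 1 = 1 :=
    PowerSeries.mul_invOfUnit _ _ (by simp)
  have h2 : (1 - PowerSeries.C f * PowerSeries.X : ℚ⟦X⟧⟦X⟧) * PowerSeries.mk (fun k => f ^ k) = 1 := by
    ext1 k
    rw [sub_mul, one_mul, mul_assoc, map_sub, PowerSeries.coeff_C_mul, PowerSeries.coeff_mk]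
    cases k with
    | zero => simp
    | succ k => rw [PowerSeries.coeff_succ_X_mul, PowerSeries.coeff_mk, PowerSeries.coeff_one,
        if_neg (by omega)]; ring
  have h3 : PowerSeries.invOfUnit (1 - PowerSeries.C f * PowerSeries.X) 1
      = PowerSeries.mk (fun k => f ^ k) := by
    calc _ = PowerSeries.invOfUnit (1 - PowerSeries.C f * PowerSeries.X) 1 *
        ((1 - PowerSeries.C f * PowerSeries.X : ℚ⟦X⟧⟦X⟧) * PowerSeries.mk (fun k => f ^ k)) := by
          rw [h2, mul_one]
      _ = _ := by rw [← mul_assoc, mul_comm _ (1 - PowerSeries.C f * PowerSeries.X), h1, one_mul]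
  rw [h3, PowerSeries.coeff_mk]

theorem coeff_rFn (f : ℚ⟦X⟧) (n : ℕ) (d : ℕ →₀ ℕ) :
    MvPowerSeries.coeff d (rFn f n) = PowerSeries.coeff n (f ^ d.degree) := by
  rw [rFn, coeff_zCoeff, coeff_alphabetProd]
  simp only [coeff_invOfUnit_one_sub]
  rw [Finsupp.prod, Finset.prod_pow_eq_pow_sum]
  rfl

theorem alphabetProd_one_sub_mul (f : ℚ⟦X⟧) :
    alphabetProd (1 - PowerSeries.C f * PowerSeries.X) *
      alphabetProd (PowerSeries.invOfUnit (1 - PowerSeries.C f * PowerSeries.X) 1) = 1 := by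
  rw [alphabetProd_mul _ _ (by simp) (by simp), PowerSeries.mul_invOfUnit _ _ (by simp),
    alphabetProd_one]

theorem coeff_alphabetProd_one_sub (f : ℚ⟦X⟧) (d : ℕ →₀ ℕ) [Decidable (∀ i, d i ≤ 1)] :
    MvPowerSeries.coeff d (alphabetProd (1 - PowerSeries.C f * PowerSeries.X)) =
      if ∀ i, d i ≤ 1 then (-f) ^ d.degree else 0 := by
  have hc (k : ℕ) : PowerSeries.coeff k (1 - PowerSeries.C f * PowerSeries.X : ℚ⟦X⟧⟦X⟧) =
      if k ≤ 1 then (-f) ^ k else 0 := by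
    rw [map_sub, PowerSeries.coeff_C_mul, PowerSeries.coeff_one, PowerSeries.coeff_X]
    rcases k with _ | _ | k <;> simp
  rw [coeff_alphabetProd]
  simp only [hc]
  split_ifs with h
  · rw [Finsupp.prod, Finset.prod_congr rfl fun i _ => if_pos (h i), Finset.prod_pow_eq_pow_sum]
    rfl
  · push Not at h
    obtain ⟨i, hi⟩ := h
    exact Finset.prod_eq_zero (Finsupp.mem_support_iff.2 (by omega)) (if_neg (not_le.2 hi))

theorem cFn_eq (f : ℚ⟦X⟧) (n : ℕ) : cFn f n =
    (-1 : ℚ) ^ n • zCoeff n (alphabetProd (1 - PowerSeries.C f * PowerSeries.X)) := by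
  classical
  ext d
  rw [cFn, coeff_zCoeff, map_smul, coeff_zCoeff, coeff_alphabetProd_one_sub,
    coeff_alphabetProd_one_sub]
  split_ifs with h
  · rw [← map_neg, ← map_pow, PowerSeries.coeff_rescale, smul_eq_mul]
  · simp

/-- `∏_x (1 - f(z) x) · ∏_x (1 - f(z) x)⁻¹ = 1`, coefficient by coefficient in `z`. -/
theorem sum_cFn_mul_rFn (f : ℚ⟦X⟧) (n : ℕ) :
    ∑ ij ∈ Finset.HasAntidiagonal.antidiagonal n, (-1 : ℚ) ^ ij.1 • (cFn f ij.1 * rFn f ij.2) =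
      if n = 0 then 1 else 0 := by
  classical
  have h := zCoeff_mul n (alphabetProd (1 - PowerSeries.C f * PowerSeries.X))
    (alphabetProd (PowerSeries.invOfUnit (1 - PowerSeries.C f * PowerSeries.X) 1))
  rw [alphabetProd_one_sub_mul] at h
  calc _ = zCoeff n 1 := by
        rw [h]
        refine Finset.sum_congr rfl fun ij _ => ?_
        rw [cFn_eq, smul_mul_assoc, smul_smul, ← mul_pow]
        simp [rFn]
    _ = _ := by
        ext d
        rw [coeff_zCoeff, MvPowerSeries.coeff_one]
        by_cases hd : d = 0 <;> by_cases hn : n = 0 <;>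
          simp [hd, hn, MvPowerSeries.coeff_one, PowerSeries.coeff_one]

theorem rFn_X (n : ℕ) : rFn PowerSeries.X n = (hFn n : MvPowerSeries ℕ ℚ) := by
  ext d
  rw [coeff_rFn, coeff_hFn, PowerSeries.coeff_X_pow]
  exact if_congr eq_comm rfl rfl

theorem cFn_X (n : ℕ) : cFn PowerSeries.X n = (eFn n : MvPowerSeries ℕ ℚ) := by
  classical
  ext d
  rw [cFn_eq, map_smul, coeff_zCoeff, coeff_alphabetProd_one_sub, coeff_eFn,
    neg_pow (PowerSeries.X : ℚ⟦X⟧)]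
  by_cases h : ∀ i, d i ≤ 1
  · rw [if_pos h]
    have hC : ((-1 : ℚ⟦X⟧) ^ d.degree) = PowerSeries.C ((-1 : ℚ) ^ d.degree) := by simp
    rw [hC, PowerSeries.coeff_C_mul, PowerSeries.coeff_X_pow]
    by_cases hn : n = d.degree
    · subst hn
      rw [if_pos rfl, if_pos ⟨rfl, h⟩, mul_one, smul_eq_mul, ← mul_pow]
      simp
    · rw [if_neg hn, if_neg fun H => hn H.1.symm]
      simp
  · rw [if_neg h, if_neg fun H => h H.2]
    simp

/-- The relation `∑ (-1)^i e_i h_{n-i} = 0` for `n > 0`. -/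
theorem sum_eFn_mul_hFn (n : ℕ) :
    ∑ ij ∈ Finset.HasAntidiagonal.antidiagonal n, (-1 : ℚ) ^ ij.1 • (eFn ij.1 * hFn ij.2) =
      if n = 0 then 1 else 0 := by
  refine Subtype.ext ?_
  have h := sum_cFn_mul_rFn PowerSeries.X n
  simp only [rFn_X, cFn_X] at h
  have h2 : ((if n = 0 then 1 else 0 : SymFun) : MvPowerSeries ℕ ℚ) = if n = 0 then 1 else 0 := by
    split_ifs <;> rfl
  rw [h2, ← h]
  simp

/-! ### Adding one variable to the alphabet -/

theorem coeff_shiftCoeff (n : ℕ) (p : SymFun) (d : ℕ →₀ ℕ) :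
    MvPowerSeries.coeff d (shiftCoeff n p : MvPowerSeries ℕ ℚ) =
      MvPowerSeries.coeff (consComp n d) (p : MvPowerSeries ℕ ℚ) := rfl

theorem symFun_ext {p q : SymFun}
    (h : ∀ d, MvPowerSeries.coeff d (p : MvPowerSeries ℕ ℚ) = MvPowerSeries.coeff d q.1) : p = q :=
  Subtype.ext (MvPowerSeries.ext h)

theorem shiftCoeff_add (n : ℕ) (p q : SymFun) :
    shiftCoeff n (p + q) = shiftCoeff n p + shiftCoeff n q := rfl

theorem sum_antidiagonal_consComp {M : Type*} [AddCommMonoid M] (F : (ℕ →₀ ℕ) × (ℕ →₀ ℕ) → M)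
    (n : ℕ) (d : ℕ →₀ ℕ) : ∑ x ∈ Finset.HasAntidiagonal.antidiagonal (consComp n d), F x =
      ∑ ij ∈ Finset.HasAntidiagonal.antidiagonal n, ∑ y ∈ Finset.HasAntidiagonal.antidiagonal d,
        F (consComp ij.1 y.1, consComp ij.2 y.2) := by
  classical
  rw [← Finset.sum_product' (f := fun ij x : _ × _ => F (consComp ij.1 x.1, consComp ij.2 x.2))]
  symm
  refine Finset.sum_bij (fun x _ => (consComp x.1.1 x.2.1, consComp x.1.2 x.2.2)) ?_ ?_ ?_ ?_
  · intro x hx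
    simp only [Finset.mem_product, Finset.HasAntidiagonal.mem_antidiagonal] at hx ⊢
    rw [consComp_add, hx.1, hx.2]
  · rintro ⟨⟨a, b⟩, c, d⟩ _ ⟨⟨a', b'⟩, c', d'⟩ _ h
    obtain ⟨h1, h2⟩ := Prod.mk.inj h
    obtain ⟨rfl, rfl⟩ := consComp_inj h1
    obtain ⟨rfl, rfl⟩ := consComp_inj h2
    rfl
  · rintro ⟨x, y⟩ hxy
    rw [Finset.HasAntidiagonal.mem_antidiagonal] at hxy
    rw [← consComp_eta x, ← consComp_eta y, consComp_add] at hxy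
    obtain ⟨h1, h2⟩ := consComp_inj hxy
    refine ⟨((x 0, y 0), (_, _)), ?_, Prod.ext (consComp_eta x) (consComp_eta y)⟩
    simp only [Finset.mem_product, Finset.HasAntidiagonal.mem_antidiagonal]
    exact ⟨h1, h2⟩
  · intro x _
    rfl

theorem shiftCoeff_mul (n : ℕ) (p q : SymFun) : shiftCoeff n (p * q) =
    ∑ ij ∈ Finset.HasAntidiagonal.antidiagonal n, shiftCoeff ij.1 p * shiftCoeff ij.2 q := by
  classical
  refine symFun_ext fun d => ?_
  rw [coeff_shiftCoeff]
  simp only [AddSubmonoidClass.coe_finsetSum, MulMemClass.coe_mul, map_sum, MvPowerSeries.coeff_mul,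
    coeff_shiftCoeff]
  rw [sum_antidiagonal_consComp fun x : _ × _ =>
    MvPowerSeries.coeff x.1 (p : MvPowerSeries ℕ ℚ) * MvPowerSeries.coeff x.2 q.1]

theorem exists_shiftCoeff_eq_zero (p : SymFun) : ∃ N, ∀ n, N < n → shiftCoeff n p = 0 := by
  obtain ⟨N, hN⟩ := p.2.2
  refine ⟨N, fun n hn => symFun_ext fun d => ?_⟩
  rw [coeff_shiftCoeff]
  refine hN _ ?_
  rw [degree_consComp]
  omega

theorem shiftCoeff_algebraMap (n : ℕ) (r : ℚ) :
    shiftCoeff n (algebraMap ℚ SymFun r) = if n = 0 then algebraMap ℚ SymFun r else 0 := by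
  classical
  refine symFun_ext fun d => ?_
  rw [coeff_shiftCoeff]
  change MvPowerSeries.coeff (consComp n d) (algebraMap ℚ (MvPowerSeries ℕ ℚ) r) = _
  rw [MvPowerSeries.algebraMap_apply, MvPowerSeries.coeff_C]
  have hiff : consComp n d = 0 ↔ n = 0 ∧ d = 0 := by
    refine ⟨fun H => consComp_inj (H.trans consComp_zero_zero.symm), ?_⟩
    rintro ⟨rfl, rfl⟩
    exact consComp_zero_zero
  simp only [hiff]
  by_cases hn : n = 0
  · simp only [hn, true_and, if_true]
    exact (MvPowerSeries.coeff_C d (algebraMap ℚ ℚ r)).symm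
  · simp only [hn, false_and, if_false]
    rfl

/-- `p ↦ p(X + u)`, the coproduct of `Λ` restricted to one variable in the second alphabet. -/
def shiftHom : SymFun →ₐ[ℚ] SymFun[X] :=
  have hc (p : SymFun) (n : ℕ) : (∑ k ∈ Finset.range ((exists_shiftCoeff_eq_zero p).choose + 1),
      Polynomial.monomial k (shiftCoeff k p)).coeff n = shiftCoeff n p := by
    simp only [Polynomial.finsetSum_coeff, Polynomial.coeff_monomial]
    rw [Finset.sum_ite_eq' (Finset.range _) n]
    split_ifs with h
    · rfl
    · rw [(exists_shiftCoeff_eq_zero p).choose_spec n]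
      rw [Finset.mem_range] at h
      omega
  have hC (r : ℚ) : (∑ k ∈ Finset.range
      ((exists_shiftCoeff_eq_zero (algebraMap ℚ SymFun r)).choose + 1),
      Polynomial.monomial k (shiftCoeff k (algebraMap ℚ SymFun r))) =
        algebraMap ℚ SymFun[X] r := by
    ext1 n
    rw [hc, shiftCoeff_algebraMap, Polynomial.algebraMap_apply, Polynomial.coeff_C]
  { toFun := fun p => ∑ k ∈ Finset.range ((exists_shiftCoeff_eq_zero p).choose + 1),
      Polynomial.monomial k (shiftCoeff k p)
    map_one' := by
      have := hC 1
      rwa [map_one, map_one] at this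
    map_zero' := by
      have := hC 0
      rwa [map_zero, map_zero] at this
    map_add' := by
      intro p q
      ext1 n
      rw [Polynomial.coeff_add, hc, hc, hc, shiftCoeff_add]
    map_mul' := by
      intro p q
      ext1 n
      rw [Polynomial.coeff_mul, hc, shiftCoeff_mul]
      simp only [hc]
    commutes' := hC }

theorem coeff_shiftHom (p : SymFun) (n : ℕ) : (shiftHom p).coeff n = shiftCoeff n p := by
  change (∑ k ∈ Finset.range ((exists_shiftCoeff_eq_zero p).choose + 1),
      Polynomial.monomial k (shiftCoeff k p)).coeff n = _
  simp only [Polynomial.finsetSum_coeff, Polynomial.coeff_monomial]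
  rw [Finset.sum_ite_eq' (Finset.range _) n]
  split_ifs with h
  · rfl
  · rw [(exists_shiftCoeff_eq_zero p).choose_spec n]
    rw [Finset.mem_range] at h
    omega

theorem shiftCoeff_hFn (k n : ℕ) :
    shiftCoeff k (hFn n) = if k ≤ n then hFn (n - k) else 0 := by
  refine symFun_ext fun d => ?_
  rw [coeff_shiftCoeff, coeff_hFn, degree_consComp]
  split_ifs with h1 h2 h2
  · rw [coeff_hFn, if_pos (by omega)]
  · omega
  · rw [coeff_hFn, if_neg (by omega)]
  · rfl

theorem shiftHom_hFn (n : ℕ) : shiftHom (hFn n) =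
    ∑ k ∈ Finset.range (n + 1), Polynomial.monomial k (hFn (n - k)) := by
  ext1 k
  rw [coeff_shiftHom, shiftCoeff_hFn]
  simp only [Polynomial.finsetSum_coeff, Polynomial.coeff_monomial]
  rw [Finset.sum_ite_eq' (Finset.range _) k]
  simp only [Finset.mem_range, Nat.lt_succ_iff]

theorem shiftCoeff_zero_eFn (n : ℕ) : shiftCoeff 0 (eFn n) = eFn n := by
  classical
  refine symFun_ext fun d => ?_
  rw [coeff_shiftCoeff, coeff_eFn, coeff_eFn, degree_consComp, zero_add]
  refine if_congr (and_congr_right fun _ => ⟨fun H i => ?_, fun H i => ?_⟩) rfl rfl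
  · have := H (i + 1)
    rwa [consComp_succ] at this
  · cases i with
    | zero => rw [consComp_zero]; omega
    | succ i => rw [consComp_succ]; exact H i

theorem shiftCoeff_one_eFn (n : ℕ) : shiftCoeff 1 (eFn (n + 1)) = eFn n := by
  classical
  refine symFun_ext fun d => ?_
  rw [coeff_shiftCoeff, coeff_eFn, coeff_eFn, degree_consComp]
  refine if_congr (and_congr (by omega) ⟨fun H i => ?_, fun H i => ?_⟩) rfl rfl
  · have := H (i + 1)
    rwa [consComp_succ] at this
  · cases i with
    | zero => rw [consComp_zero]
    | succ i => rw [consComp_succ]; exact H i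

theorem shiftCoeff_eFn_of_two_le {k : ℕ} (hk : 2 ≤ k) (n : ℕ) : shiftCoeff k (eFn n) = 0 := by
  classical
  refine symFun_ext fun d => ?_
  rw [coeff_shiftCoeff, coeff_eFn, if_neg]
  · rfl
  · rintro ⟨-, H⟩
    have := H 0
    rw [consComp_zero] at this
    omega

theorem shiftHom_eFn_succ (n : ℕ) : shiftHom (eFn (n + 1)) =
    Polynomial.C (eFn (n + 1)) + Polynomial.X * Polynomial.C (eFn n) := by
  ext1 k
  rw [coeff_shiftHom, Polynomial.coeff_add, Polynomial.coeff_C]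
  rcases k with _ | _ | k
  · simp [shiftCoeff_zero_eFn]
  · simp [shiftCoeff_one_eFn]
  · rw [shiftCoeff_eFn_of_two_le (by omega), Polynomial.coeff_X_mul, Polynomial.coeff_C]
    simp

/-! ### The polynomial ring in the complete functions, and the pairing with it -/

/-- `h_n` as an element of the polynomial ring in the indeterminates `h₁, h₂, …`. -/
def hVar (n : ℕ) : MvPolynomial ℕ ℚ := MvPolynomial.monomial (genExp n) 1

theorem hVar_zero : hVar 0 = 1 := rfl

theorem hVar_succ (n : ℕ) : hVar (n + 1) = MvPolynomial.X n := rfl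

/-- The evaluation of polynomials in `h₁, h₂, …` as symmetric functions. -/
def hEval : MvPolynomial ℕ ℚ →ₐ[ℚ] SymFun := MvPolynomial.aeval fun n => hFn (n + 1)

theorem hEval_hVar (n : ℕ) : hEval (hVar n) = hFn n := by
  cases n with
  | zero => rw [hVar_zero, map_one, hFn_zero]
  | succ n => rw [hVar_succ, hEval, MvPolynomial.aeval_X]

theorem prod_hVar (d : ℕ →₀ ℕ) :
    (d.prod fun _ k => hVar k) = MvPolynomial.monomial (partMult d) 1 := by
  rw [partMult, Finsupp.sum, Finsupp.prod, MvPolynomial.monomial_sum_one]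
  rfl

theorem hEval_prod_hVar (d : ℕ →₀ ℕ) : hEval (d.prod fun _ k => hVar k) = hProd d := by
  rw [map_finsuppProd, hProd]
  simp only [hEval_hVar]

/-- The pairing of series with polynomials in `h₁, h₂, …`: a product of `h`s extracts the
coefficient of a monomial with the corresponding exponents. Which one does not matter for symmetric
series. -/
def polyPairing : MvPowerSeries ℕ ℚ →ₗ[ℚ] MvPolynomial ℕ ℚ →ₗ[ℚ] ℚ :=
  ((MvPolynomial.basisMonomials ℕ ℚ).constr ℚ fun m =>
    MvPowerSeries.coeff (R := ℚ) (exists_partMult_eq m).choose).flip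

theorem polyPairing_monomial {w : MvPowerSeries ℕ ℚ} (hw : w ∈ SymSeries) (d : ℕ →₀ ℕ) :
    polyPairing w (MvPolynomial.monomial (partMult d) 1) = MvPowerSeries.coeff d w := by
  have h := (MvPolynomial.basisMonomials ℕ ℚ).constr_basis ℚ (fun m =>
    MvPowerSeries.coeff (R := ℚ) (exists_partMult_eq m).choose) (partMult d)
  rw [MvPolynomial.coe_basisMonomials] at h
  rw [polyPairing, LinearMap.flip_apply, h]
  exact coeff_eq_of_partMult_eq hw (exists_partMult_eq (partMult d)).choose_spec

theorem polyPairing_prod_hVar {w : MvPowerSeries ℕ ℚ} (hw : w ∈ SymSeries) (d : ℕ →₀ ℕ) :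
    polyPairing w (d.prod fun _ k => hVar k) = MvPowerSeries.coeff d w := by
  rw [prod_hVar, polyPairing_monomial hw]

theorem linearMap_ext_prod_hVar {M : Type*} [AddCommMonoid M] [Module ℚ M]
    {α β : MvPolynomial ℕ ℚ →ₗ[ℚ] M}
    (h : ∀ d : ℕ →₀ ℕ, α (d.prod fun _ k => hVar k) = β (d.prod fun _ k => hVar k)) : α = β := by
  refine (MvPolynomial.basisMonomials ℕ ℚ).ext fun m => ?_
  obtain ⟨d, rfl⟩ := exists_partMult_eq m
  rw [MvPolynomial.coe_basisMonomials]
  simpa only [prod_hVar] using h d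

/-- Multiplication by `h_a` is adjoint to `∂_{h_a}`. -/
theorem polyPairing_hVar_mul (a : ℕ) (p : SymFun) (F : MvPolynomial ℕ ℚ) :
    polyPairing (p : MvPowerSeries ℕ ℚ) (hVar a * F) =
      polyPairing (shiftCoeff a p : MvPowerSeries ℕ ℚ) F := by
  have h : (polyPairing (p : MvPowerSeries ℕ ℚ)).comp (LinearMap.mulLeft ℚ (hVar a)) =
      polyPairing (shiftCoeff a p : MvPowerSeries ℕ ℚ) := by
    refine linearMap_ext_prod_hVar fun d => ?_
    rw [LinearMap.comp_apply, LinearMap.mulLeft_apply, ← prod_consComp _ hVar_zero,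
      polyPairing_prod_hVar p.2.1, polyPairing_prod_hVar (shiftCoeff a p).2.1, coeff_shiftCoeff]
  exact LinearMap.congr_fun h F

/-- The lift of `shiftHom` to polynomials in `h₁, h₂, …`. -/
def shiftPoly : MvPolynomial ℕ ℚ →ₐ[ℚ] (MvPolynomial ℕ ℚ)[X] :=
  MvPolynomial.aeval fun n =>
    ∑ k ∈ Finset.range (n + 1 + 1), Polynomial.monomial k (hVar (n + 1 - k))

theorem shiftPoly_hVar (n : ℕ) : shiftPoly (hVar n) =
    ∑ k ∈ Finset.range (n + 1), Polynomial.monomial k (hVar (n - k)) := by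
  cases n with
  | zero => simp [hVar_zero]
  | succ n => rw [hVar_succ, shiftPoly, MvPolynomial.aeval_X]

theorem coeff_shiftPoly_hVar (k n : ℕ) :
    (shiftPoly (hVar n)).coeff k = if k ≤ n then hVar (n - k) else 0 := by
  rw [shiftPoly_hVar]
  simp only [Polynomial.finsetSum_coeff, Polynomial.coeff_monomial]
  rw [Finset.sum_ite_eq' (Finset.range _) k]
  simp only [Finset.mem_range, Nat.lt_succ_iff]

theorem hEval_coeff_shiftPoly (n : ℕ) (F : MvPolynomial ℕ ℚ) :
    hEval ((shiftPoly F).coeff n) = shiftCoeff n (hEval F) := by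
  have h : (Polynomial.mapAlgHom hEval).comp shiftPoly = shiftHom.comp hEval := by
    refine MvPolynomial.algHom_ext fun n => ?_
    rw [AlgHom.comp_apply, AlgHom.comp_apply, ← hVar_succ, hEval_hVar, shiftHom_hFn,
      shiftPoly_hVar, map_sum]
    refine Finset.sum_congr rfl fun k _ => ?_
    rw [Polynomial.coe_mapAlgHom, Polynomial.map_monomial]
    exact congrArg _ (hEval_hVar _)
  have h2 := congrArg (Polynomial.coeff · n) (DFunLike.congr_fun h F)
  simp only [AlgHom.comp_apply, Polynomial.coe_mapAlgHom, Polynomial.coeff_map,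
    coeff_shiftHom] at h2
  exact h2

/-- The other half of the adjunction between `h_a` and `∂_{h_a}`. Both `∂_{h_b} h_a` and
`∂_{h_a} h_b` are expanded by the product rule, which gives the same sum. -/
theorem polyPairing_hFn_mul (a : ℕ) (p : SymFun) (F : MvPolynomial ℕ ℚ) :
    polyPairing ((hFn a * p : SymFun) : MvPowerSeries ℕ ℚ) F =
      polyPairing (p : MvPowerSeries ℕ ℚ) ((shiftPoly F).coeff a) := by
  induction F using MvPolynomial.induction_on generalizing a p with
  | C r =>
    have h1 (w : SymFun) : polyPairing (w : MvPowerSeries ℕ ℚ) (MvPolynomial.C r) =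
        r * MvPowerSeries.constantCoeff (w : MvPowerSeries ℕ ℚ) := by
      have := polyPairing_monomial w.2.1 0
      rw [partMult_zero] at this
      rw [← mul_one (MvPolynomial.C r), ← MvPolynomial.smul_eq_C_mul, map_smul, smul_eq_mul]
      exact congrArg _ this
    have h2 : shiftPoly (MvPolynomial.C r) = Polynomial.C (MvPolynomial.C r) :=
      AlgHom.commutes shiftPoly r
    rw [h1, h2, Polynomial.coeff_C, MulMemClass.coe_mul, map_mul]
    have h3 : MvPowerSeries.constantCoeff (hFn a : MvPowerSeries ℕ ℚ) = if a = 0 then 1 else 0 := by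
      rw [← MvPowerSeries.coeff_zero_eq_constantCoeff_apply, coeff_hFn, map_zero]
      exact if_congr eq_comm rfl rfl
    rw [h3]
    split_ifs
    · rw [one_mul, h1]
    · rw [zero_mul, mul_zero, map_zero]
  | add F G hF hG =>
    rw [map_add, map_add, Polynomial.coeff_add, map_add, hF, hG]
  | mul_X F n hF =>
    rw [← hVar_succ, mul_comm F, polyPairing_hVar_mul, shiftCoeff_mul, map_mul,
      Polynomial.coeff_mul, Finset.Nat.sum_antidiagonal_eq_sum_range_succ_mk,
      Finset.Nat.sum_antidiagonal_eq_sum_range_succ_mk, map_sum]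
    simp only [AddSubmonoidClass.coe_finsetSum, map_sum, LinearMap.sum_apply]
    have hl (i : ℕ) : polyPairing ((shiftCoeff i (hFn a) * shiftCoeff (n + 1 - i) p : SymFun) :
        MvPowerSeries ℕ ℚ) F = if i ≤ a then polyPairing (p : MvPowerSeries ℕ ℚ)
          (hVar (n + 1 - i) * (shiftPoly F).coeff (a - i)) else 0 := by
      rw [shiftCoeff_hFn]
      split_ifs
      · rw [hF, polyPairing_hVar_mul]
      · rw [zero_mul, ZeroMemClass.coe_zero, map_zero, LinearMap.zero_apply]
    have hr (i : ℕ) : polyPairing (p : MvPowerSeries ℕ ℚ)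
        ((shiftPoly (hVar (n + 1))).coeff i * (shiftPoly F).coeff (a - i)) =
          if i ≤ n + 1 then polyPairing (p : MvPowerSeries ℕ ℚ)
          (hVar (n + 1 - i) * (shiftPoly F).coeff (a - i)) else 0 := by
      rw [coeff_shiftPoly_hVar]
      split_ifs
      · rfl
      · rw [zero_mul, map_zero]
    simp only [hl, hr]
    rw [← Finset.sum_filter, ← Finset.sum_filter]
    refine Finset.sum_congr (Finset.ext fun i => ?_) fun _ _ => rfl
    simp only [Finset.mem_filter, Finset.mem_range]
    omega

/-- The pairing is symmetric. -/
theorem polyPairing_hEval_comm (F G : MvPolynomial ℕ ℚ) :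
    polyPairing (hEval F : MvPowerSeries ℕ ℚ) G = polyPairing (hEval G : MvPowerSeries ℕ ℚ) F := by
  induction F using MvPolynomial.induction_on generalizing G with
  | C r =>
    have hC : (MvPolynomial.C r : MvPolynomial ℕ ℚ) = r • 1 := by
      rw [MvPolynomial.smul_eq_C_mul, mul_one]
    rw [hC, map_smul, map_smul]
    have h1 (w : SymFun) : polyPairing (w : MvPowerSeries ℕ ℚ) 1 =
        MvPowerSeries.constantCoeff (w : MvPowerSeries ℕ ℚ) := by
      have := polyPairing_monomial w.2.1 0
      rwa [partMult_zero] at this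
    rw [h1, map_one]
    change polyPairing (r • ((1 : SymFun) : MvPowerSeries ℕ ℚ)) G = _
    rw [map_smul, LinearMap.smul_apply]
    congr 1
    induction G using MvPolynomial.induction_on with
    | C s =>
      have hC : (MvPolynomial.C s : MvPolynomial ℕ ℚ) = s • 1 := by
        rw [MvPolynomial.smul_eq_C_mul, mul_one]
      rw [hC, map_smul, map_smul, h1, map_one]
      change _ = MvPowerSeries.constantCoeff (s • ((1 : SymFun) : MvPowerSeries ℕ ℚ))
      simp
    | add F G hF hG => simp only [map_add, hF, hG, AddMemClass.coe_add]
    | mul_X F n _ =>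
      rw [← hVar_succ, mul_comm, polyPairing_hVar_mul, map_mul, hEval_hVar, MulMemClass.coe_mul,
        map_mul, ← MvPowerSeries.coeff_zero_eq_constantCoeff_apply, coeff_hFn, if_neg (by simp),
        zero_mul]
      have : shiftCoeff (n + 1) (1 : SymFun) = 0 := by
        have := shiftCoeff_algebraMap (n + 1) 1
        rwa [map_one, if_neg (by omega)] at this
      rw [this, ZeroMemClass.coe_zero, map_zero, LinearMap.zero_apply]
  | add F F' hF hF' =>
    simp only [map_add, AddMemClass.coe_add, LinearMap.add_apply, hF, hF']
  | mul_X F n hF =>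
    rw [← hVar_succ, mul_comm, map_mul, hEval_hVar, polyPairing_hFn_mul, hF,
      hEval_coeff_shiftPoly, polyPairing_hVar_mul]

/-! ### Jacobi–Trudi determinants -/

theorem extZ_natCast {R : Type*} [Zero R] (s : ℕ → R) (n : ℕ) : extZ s n = s n := rfl

theorem extZ_of_neg {R : Type*} [Zero R] (s : ℕ → R) {k : ℤ} (hk : k < 0) : extZ s k = 0 := by
  obtain ⟨n, rfl⟩ := Int.eq_negSucc_of_lt_zero hk
  rfl

theorem map_extZ {R S F : Type*} [Zero R] [Zero S] [FunLike F R S] [ZeroHomClass F R S] (φ : F)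
    (s : ℕ → R) (k : ℤ) : φ (extZ s k) = extZ (fun n => φ (s n)) k := by
  cases k with
  | ofNat n => rfl
  | negSucc n => exact map_zero φ

/-- `det (s_{aᵢ + j - i})`, of size `N`. -/
def seqDet {R : Type*} [CommRing R] (s : ℕ → R) (N : ℕ) (a : ℕ → ℕ) : R :=
  (Matrix.of fun i j : Fin N => extZ s ((a i : ℤ) + (j : ℤ) - (i : ℤ))).det

section SeqDet

variable {R : Type*} [CommRing R]

theorem rowDet_eq_seqDet (s : ℕ → R) (lam : YoungDiagram) :
    rowDet s lam = seqDet s (lam.colLen 0) lam.rowLen := rfl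

theorem map_seqDet {S F : Type*} [CommRing S] [FunLike F R S] [RingHomClass F R S] (φ : F)
    (s : ℕ → R) (N : ℕ) (a : ℕ → ℕ) : φ (seqDet s N a) = seqDet (fun n => φ (s n)) N a := by
  rw [seqDet, seqDet]
  refine (RingHom.map_det (φ : R →+* S) _).trans ?_
  congr 1
  ext i j
  exact map_extZ φ s _

theorem seqDet_congr (s : ℕ → R) (N : ℕ) {a b : ℕ → ℕ} (h : ∀ i < N, a i = b i) :
    seqDet s N a = seqDet s N b := by
  rw [seqDet, seqDet]
  congr 1
  ext i j
  rw [Matrix.of_apply, Matrix.of_apply, h i i.2]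

theorem seqDet_succ_of_eq_zero {s : ℕ → R} (h0 : s 0 = 1) {N : ℕ} {a : ℕ → ℕ} (ha : a N = 0) :
    seqDet s (N + 1) a = seqDet s N a := by
  rw [seqDet, Matrix.det_succ_row _ (Fin.last N), Fin.sum_univ_castSucc, Finset.sum_eq_zero]
  · have h1 : extZ s ((a N : ℤ) + N - N) = 1 := by
      rw [ha, add_sub_cancel_right]
      exact h0
    simp only [Matrix.of_apply, Fin.val_last, h1, Fin.succAbove_last, zero_add, mul_one]
    rw [← two_mul, pow_mul, neg_one_sq, one_pow, one_mul]
    rfl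
  · intro j _
    rw [Matrix.of_apply, extZ_of_neg, mul_zero, zero_mul]
    have := j.2
    simp only [Fin.val_last, ha, Fin.val_castSucc]
    omega

theorem seqDet_eq_of_le {s : ℕ → R} (h0 : s 0 = 1) {N M : ℕ} (hNM : N ≤ M) {a : ℕ → ℕ}
    (ha : ∀ i, N ≤ i → a i = 0) : seqDet s M a = seqDet s N a := by
  induction M, hNM using Nat.le_induction with
  | base => rfl
  | succ M hM ih => rw [seqDet_succ_of_eq_zero h0 (ha M hM), ih]

theorem rowDet_eq_seqDet_of_le {s : ℕ → R} (h0 : s 0 = 1) (lam : YoungDiagram) {N : ℕ}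
    (hN : lam.colLen 0 ≤ N) : rowDet s lam = seqDet s N lam.rowLen := by
  rw [rowDet_eq_seqDet, seqDet_eq_of_le h0 hN]
  intro i hi
  by_contra H
  have := YoungDiagram.mem_iff_lt_colLen.1 (YoungDiagram.mem_iff_lt_rowLen.2 (Nat.pos_of_ne_zero H))
  omega

open Polynomial in
/-- A linear functional on polynomials can be applied to the determinant of a matrix with a single
non-constant column by applying it to that column. -/
theorem linearMap_det_col_zero (L : R[X] →ₗ[R] R) {n : ℕ} (v : Fin (n + 1) → R[X])
    (B : Matrix (Fin (n + 1)) (Fin n) R) :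
    L (Matrix.of fun i => (Fin.cons (v i) fun j => C (B i j) : Fin (n + 1) → R[X])).det =
      (Matrix.of fun i => (Fin.cons (L (v i)) (B i) : Fin (n + 1) → R)).det := by
  rw [Matrix.det_succ_column_zero, Matrix.det_succ_column_zero, map_sum]
  refine Finset.sum_congr rfl fun i _ => ?_
  have h1 : (Matrix.of fun i => (Fin.cons (v i) fun j => C (B i j) : Fin (n + 1) → R[X])).submatrix
      i.succAbove Fin.succ = (C : R →+* R[X]).mapMatrix (B.submatrix i.succAbove id) := by
    ext1 k j
    simp
  have h2 : (Matrix.of fun i => (Fin.cons (L (v i)) (B i) : Fin (n + 1) → R)).submatrix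
      i.succAbove Fin.succ = B.submatrix i.succAbove id := by
    ext1 k j
    simp
  rw [h1, h2, ← RingHom.map_det]
  simp only [Matrix.of_apply, Fin.cons_zero]
  have h3 : (-1 : R[X]) ^ (i : ℕ) * v i * C (B.submatrix i.succAbove id).det =
      ((-1) ^ (i : ℕ) * (B.submatrix i.succAbove id).det) • v i := by
    rw [smul_eq_C_mul, map_mul, map_pow, map_neg, map_one]
    ring
  rw [h3, map_smul, smul_eq_mul]
  ring

open Polynomial in
theorem linearMap_det_row_zero (L : R[X] →ₗ[R] R) {n : ℕ} (v : Fin (n + 1) → R[X])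
    (B : Matrix (Fin n) (Fin (n + 1)) R) :
    L (Matrix.of (Fin.cons v fun i j => C (B i j) : Fin (n + 1) → Fin (n + 1) → R[X])).det =
      (Matrix.of (Fin.cons (fun j => L (v j)) B : Fin (n + 1) → Fin (n + 1) → R)).det := by
  have h1 : (Matrix.of (Fin.cons v fun i j => C (B i j) : Fin (n + 1) → Fin (n + 1) → R[X])) =
      (Matrix.of fun i => (Fin.cons (v i) fun j => C (B.transpose i j) :
        Fin (n + 1) → R[X])).transpose := by
    ext1 i j
    refine Fin.cases ?_ (fun i => ?_) i <;> rfl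
  have h2 : (Matrix.of (Fin.cons (fun j => L (v j)) B : Fin (n + 1) → Fin (n + 1) → R)) =
      (Matrix.of fun i => (Fin.cons (L (v i)) (B.transpose i) : Fin (n + 1) → R)).transpose := by
    ext1 i j
    refine Fin.cases ?_ (fun i => ?_) i <;> rfl
  rw [h1, h2, Matrix.det_transpose, Matrix.det_transpose]
  exact linearMap_det_col_zero L v B.transpose

end SeqDet

/-! ### Column operators on determinants -/

section ColumnOperators

variable {R : Type*} [CommRing R] {e h : ℕ → R} {T : R →+* R[X]}

theorem neg_one_pow_smul_rat [Algebra ℚ R] (n : ℕ) (x : R) : (-1 : ℚ) ^ n • x = (-1) ^ n * x := by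
  rw [Algebra.smul_def, map_pow, map_neg, map_one]

open Polynomial in
/-- The linear functional `u ^ n ↦ (-1) ^ n e_{m+n}` on polynomials in `u`. The column operator
`C_m` on symmetric functions is its composite with `p ↦ p(X + u)`. -/
def colFunctional [Algebra ℚ R] (e : ℕ → R) (m : ℕ) : R[X] →ₗ[R] R :=
  Polynomial.lsum fun n => ((-1 : ℚ) ^ n • e (m + n)) • LinearMap.id

theorem colFunctional_monomial [Algebra ℚ R] (m n : ℕ) (c : R) :
    colFunctional e m (Polynomial.monomial n c) = (-1) ^ n * e (m + n) * c := by
  rw [colFunctional, Polynomial.lsum_apply]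
  refine (Polynomial.sum_monomial_index _ _ (by simp)).trans ?_
  rw [neg_one_pow_smul_rat]
  rfl

theorem map_extZ_of_elementary
    (he0 : e 0 = 1)
    (hTe : ∀ n, T (e (n + 1)) = Polynomial.C (e (n + 1)) + Polynomial.X * Polynomial.C (e n))
    (k : ℤ) : T (extZ e k) =
    Polynomial.C (extZ e k) + Polynomial.X * Polynomial.C (extZ e (k - 1)) := by
  rcases k with (_ | n) | n
  · change T (e 0) = Polynomial.C (e 0) + Polynomial.X * Polynomial.C (0 : R)
    rw [he0, map_one, map_one, map_zero, mul_zero, add_zero]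
  · have : ((Int.ofNat (n + 1) : ℤ) - 1) = n := by simp
    rw [this]
    exact hTe n
  · rw [extZ_of_neg e (Int.negSucc_lt_zero n), extZ_of_neg e (by omega)]
    simp

theorem map_extZ_of_complete
    (hh0 : h 0 = 1)
    (hTh : ∀ n, T (h n) = ∑ k ∈ Finset.range (n + 1), Polynomial.monomial k (h (n - k)))
    (k : ℤ) : T (extZ h k) =
    Polynomial.C (extZ h k) + Polynomial.X * T (extZ h (k - 1)) := by
  rcases k with (_ | n) | n
  · change T (h 0) = Polynomial.C (h 0) + Polynomial.X * T (0 : R)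
    rw [hh0, map_one, map_one, map_zero, mul_zero, add_zero]
  · have : ((Int.ofNat (n + 1) : ℤ) - 1) = n := by simp
    rw [this]
    change T (h (n + 1)) = Polynomial.C (h (n + 1)) + Polynomial.X * T (h n)
    rw [hTh, hTh, Finset.sum_range_succ', Finset.mul_sum, add_comm]
    congr 1
    refine Finset.sum_congr rfl fun k _ => ?_
    rw [Polynomial.X_mul_monomial, Nat.add_sub_add_right]
  · rw [extZ_of_neg h (Int.negSucc_lt_zero n), extZ_of_neg h (by omega)]
    simp

/-- On determinants in the `e_n`, the column operator adds a row on top: the determinant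
`p(X + u)` is that of a matrix with the additional first row `1, -u, u², …`, of which `C_m`
turns the entries into `e_m, e_{m+1}, …`. -/
theorem colFunctional_map_seqDet_of_elementary [Algebra ℚ R]
    (he0 : e 0 = 1)
    (hTe : ∀ n, T (e (n + 1)) = Polynomial.C (e (n + 1)) + Polynomial.X * Polynomial.C (e n))
    (N : ℕ) (b : ℕ → ℕ) :
    colFunctional e (b 0) (T (seqDet e N fun i => b (i + 1))) = seqDet e (N + 1) b := by
  let E : Matrix (Fin N) (Fin (N + 1)) R := Matrix.of fun i j =>
    extZ e ((b (i + 1) : ℤ) + (j : ℤ) - (i : ℤ) - 1)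
  let A : Matrix (Fin (N + 1)) (Fin (N + 1)) R[X] := Matrix.of
    (Fin.cons (fun j => (-Polynomial.X) ^ (j : ℕ)) fun i j => Polynomial.C (E i j))
  let B : Matrix (Fin (N + 1)) (Fin (N + 1)) R[X] := Matrix.of fun i =>
    Fin.cons (A i 0) fun j => A i j.succ + Polynomial.X * A i j.castSucc
  have hAB : A.det = B.det := by
    refine Matrix.det_eq_of_forall_col_eq_smul_add_pred (fun _ => -Polynomial.X) (fun i => rfl) ?_
    intro i j
    change A i j.succ = (A i j.succ + Polynomial.X * A i j.castSucc) + -Polynomial.X * _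
    ring
  have hB : B.det = T (seqDet e N fun i => b (i + 1)) := by
    rw [Matrix.det_succ_row_zero, Fin.sum_univ_succ, Finset.sum_eq_zero, add_zero, seqDet,
      RingHom.map_det]
    · have h00 : B 0 0 = 1 := pow_zero (-Polynomial.X : R[X])
      rw [h00]
      simp only [Fin.val_zero, pow_zero, one_mul, Fin.succAbove_zero]
      congr 1
      ext1 i j
      change Polynomial.C (extZ e _) + Polynomial.X * Polynomial.C (extZ e _) =
        T (extZ e _)
      rw [map_extZ_of_elementary he0 hTe]
      refine congrArg₂ (fun x y => Polynomial.C (extZ e x) + Polynomial.X * Polynomial.C (extZ e y))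
        ?_ ?_
      · simp
        ring
      · simp
    · intro j _
      have h0 : B 0 j.succ = 0 := by
        change (-Polynomial.X) ^ (j.succ : ℕ) + Polynomial.X * (-Polynomial.X) ^ (j : ℕ) = 0
        rw [Fin.val_succ]
        ring
      rw [h0, mul_zero, zero_mul]
  rw [← hB, ← hAB, linearMap_det_row_zero, seqDet]
  congr 1
  ext1 i j
  refine Fin.cases ?_ (fun i => ?_) i
  · change colFunctional e (b 0) ((-Polynomial.X) ^ (j : ℕ)) = extZ e ((b 0 : ℤ) + (j : ℤ) - (0 : ℕ))
    have : ((b 0 : ℤ) + (j : ℤ) - (0 : ℕ)) = ((b 0 + j : ℕ) : ℤ) := by push_cast; ring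
    rw [this, extZ_natCast, neg_pow]
    have h2 : (-1 : R[X]) ^ (j : ℕ) * Polynomial.X ^ (j : ℕ) =
        Polynomial.monomial (j : ℕ) ((-1) ^ (j : ℕ)) := by
      rw [← Polynomial.C_mul_X_pow_eq_monomial, map_pow, map_neg, map_one]
    rw [h2, colFunctional_monomial, mul_right_comm, ← mul_pow]
    simp
  · change extZ e _ = extZ e _
    congr 1
    simp
    ring

/-- The relation between the `e_n` and the `h_n`, with the sum extended by zeros. -/
theorem sum_mul_extZ_eq_zero [Algebra ℚ R]
    (hrel : ∀ n, ∑ ij ∈ Finset.HasAntidiagonal.antidiagonal n,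
      (-1 : ℚ) ^ ij.1 • (e ij.1 * h ij.2) = if n = 0 then 1 else 0)
    {K M : ℕ} (hK : 0 < K) (hM : K < M) :
    ∑ t ∈ Finset.range M, (-1) ^ t * e t * extZ h ((K : ℤ) - t) = 0 := by
  have hK' := hrel K
  rw [if_neg hK.ne', Finset.Nat.sum_antidiagonal_eq_sum_range_succ_mk] at hK'
  rw [← hK']
  symm
  refine Finset.sum_subset_zero_on_sdiff (fun t ht => ?_) (fun t ht => ?_) fun t ht => ?_
  · rw [Finset.mem_range] at *
    omega
  · rw [Finset.mem_sdiff, Finset.mem_range, Finset.mem_range] at ht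
    rw [extZ_of_neg _ (by omega), mul_zero]
  · rw [Finset.mem_range] at ht
    have : ((K : ℤ) - t) = ((K - t : ℕ) : ℤ) := by omega
    rw [this, extZ_natCast, mul_assoc, neg_one_pow_smul_rat]

/-- The column operator on a single `h_k`: the `e`–`h` relation in degree `k + l` splits into the
terms with `e_t`, `t ≥ l`, which make up `C_l[h_k]`, and those with `t < l`. -/
theorem colFunctional_map_extZ_of_complete [Algebra ℚ R]
    (hTh : ∀ n, T (h n) = ∑ k ∈ Finset.range (n + 1), Polynomial.monomial k (h (n - k)))
    (hrel : ∀ n, ∑ ij ∈ Finset.HasAntidiagonal.antidiagonal n,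
      (-1 : ℚ) ^ ij.1 • (e ij.1 * h ij.2) = if n = 0 then 1 else 0)
    {l : ℕ} {k : ℤ} (hk : 0 < k + l) :
    colFunctional e l (T (extZ h k)) =
      (-1) ^ (l + 1) * ∑ t ∈ Finset.range l, (-1) ^ t * e t * extZ h (k + l - t) := by
  have h1 : colFunctional e l (T (extZ h k)) =
      ∑ n ∈ Finset.range (k + 1).toNat, (-1) ^ n * e (l + n) * extZ h (k - n) := by
    rcases k with n | n
    · change colFunctional e l (T (h n)) =
        ∑ i ∈ Finset.range (n + 1), _
      rw [hTh, map_sum]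
      refine Finset.sum_congr rfl fun i hi => ?_
      rw [Finset.mem_range] at hi
      have : (Int.ofNat n - i : ℤ) = ((n - i : ℕ) : ℤ) := by
        rw [Int.ofNat_eq_natCast]
        omega
      rw [colFunctional_monomial, this, extZ_natCast]
    · rw [extZ_of_neg h (Int.negSucc_lt_zero n), map_zero, map_zero,
        Int.toNat_of_nonpos (by omega), Finset.sum_range_zero]
  have h2 := sum_mul_extZ_eq_zero hrel (K := (k + l).toNat) (M := l + (k + 1).toNat)
    (by omega) (by omega)
  rw [Finset.sum_range_add, Int.toNat_of_nonneg hk.le] at h2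
  have h3 : ∑ n ∈ Finset.range (k + 1).toNat, (-1) ^ (l + n) * e (l + n) *
      extZ h (k + l - ((l + n : ℕ) : ℤ)) = (-1) ^ l * colFunctional e l (T (extZ h k)) := by
    rw [h1, Finset.mul_sum]
    refine Finset.sum_congr rfl fun n _ => ?_
    have : k + l - ((l + n : ℕ) : ℤ) = k - n := by push_cast; ring
    rw [this, pow_add]
    ring
  rw [h3] at h2
  have h4 : ((-1 : R) ^ l) * (-1) ^ l = 1 := by rw [← mul_pow]; simp
  calc _ = ((-1 : R) ^ l * (-1) ^ l) * colFunctional e l (T (extZ h k)) := by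
        rw [h4, one_mul]
    _ = _ := by
        rw [mul_assoc, eq_neg_of_add_eq_zero_right h2]
        ring

/-- On determinants in the `h_n`, the column operator `C_l` with `l` the size adds `1` to all
parts. The columns of `p(X + u)` but the first can be made constant; `C_l` turns the first into a
combination of the others and a new last column. -/
theorem colFunctional_map_seqDet_of_complete [Algebra ℚ R] (he0 : e 0 = 1)
    (hh0 : h 0 = 1)
    (hTh : ∀ n, T (h n) = ∑ k ∈ Finset.range (n + 1), Polynomial.monomial k (h (n - k)))
    (hrel : ∀ n, ∑ ij ∈ Finset.HasAntidiagonal.antidiagonal n,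
      (-1 : ℚ) ^ ij.1 • (e ij.1 * h ij.2) = if n = 0 then 1 else 0)
    (N : ℕ) (a : ℕ → ℕ) :
    colFunctional e (N + 1) (T (seqDet h (N + 1) a)) = seqDet h (N + 1) fun i => a i + 1 := by
  -- `W` is the matrix of the result, `A` the same with its last column moved to the front, and `c`
  -- holds the coefficients that express `C_l` of the first column through the columns of `A`.
  let W : Matrix (Fin (N + 1)) (Fin (N + 1)) R := Matrix.of fun i j =>
    extZ h ((a i : ℤ) + 1 + (j : ℤ) - (i : ℤ))
  let A : Matrix (Fin (N + 1)) (Fin (N + 1)) R := Matrix.of fun i =>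
    Fin.cons (W i (Fin.last N)) fun j => W i j.castSucc
  have hW : W.det = (-1) ^ N * A.det := by
    have hWA : W = A.submatrix id (finRotate (N + 1)) := by
      ext1 i j
      rw [Matrix.submatrix_apply]
      refine Fin.lastCases ?_ (fun j => ?_) j
      · rw [finRotate_last]; rfl
      · rw [finRotate_of_lt (by simp)]; rfl
    rw [hWA, Matrix.det_permute', sign_finRotate]
    simp
  let c : Fin (N + 1) → R := Fin.cons ((-1) ^ N) fun j =>
    (-1) ^ N * ((-1) ^ (N - (j : ℕ)) * e (N - j))
  have h1 : T (seqDet h (N + 1) a) = (Matrix.of fun i : Fin (N + 1) =>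
      (Fin.cons (T (extZ h ((a i : ℤ) - (i : ℤ)))) fun j : Fin N =>
        Polynomial.C (W i j.castSucc) : Fin (N + 1) → R[X])).det := by
    rw [seqDet, RingHom.map_det]
    refine Matrix.det_eq_of_forall_col_eq_smul_add_pred (fun _ => Polynomial.X) (fun i => ?_)
      fun i j => ?_
    · change T (extZ h _) = T (extZ h _)
      congr 2
    · change T (extZ h _) = Polynomial.C (extZ h _) +
        Polynomial.X * T (extZ h _)
      rw [map_extZ_of_complete hh0 hTh]
      congr 4 <;> simp <;> ring
  rw [h1]
  refine (linearMap_det_col_zero (colFunctional e (N + 1))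
    (fun i : Fin (N + 1) => T (extZ h ((a i : ℤ) - (i : ℤ))))
    (Matrix.of fun i j => W i j.castSucc)).trans ?_
  have h2 : (Matrix.of fun i : Fin (N + 1) =>
      (Fin.cons (colFunctional e (N + 1) (T (extZ h ((a i : ℤ) - (i : ℤ)))))
        fun j : Fin N => W i j.castSucc : Fin (N + 1) → R)) =
      A.updateCol 0 fun k => ∑ i, c i • A k i := by
    ext1 i j
    refine Fin.cases ?_ (fun j => ?_) j
    · rw [Matrix.updateCol_self]
      change colFunctional e (N + 1) (T (extZ h ((a i : ℤ) - (i : ℤ)))) = _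
      rw [colFunctional_map_extZ_of_complete hTh hrel (by have := i.2; push_cast; omega),
        Fin.sum_univ_succ, Finset.sum_range_succ', mul_add, add_comm]
      congr 1
      · change _ = (-1) ^ N * extZ h _
        rw [he0, pow_zero, one_mul, one_mul, add_assoc, pow_add, one_add_one_eq_two, neg_one_sq,
          mul_one]
        congr 2
        simp
        ring
      · rw [Finset.mul_sum, ← Fin.sum_univ_eq_sum_range (fun t => (-1) ^ (N + 1 + 1) *
          ((-1) ^ (t + 1) * e (t + 1) * extZ h _)) N,
          ← Equiv.sum_comp Fin.revPerm]
        refine Finset.sum_congr rfl fun j _ => ?_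
        change _ = ((-1) ^ N * ((-1) ^ (N - (j : ℕ)) * e (N - j))) * extZ h _
        have hj := j.2
        have hrev : ((Fin.revPerm j : Fin N) : ℕ) + 1 = N - j := by
          rw [Fin.revPerm_apply, Fin.val_rev]
          omega
        rw [hrev, add_assoc, pow_add (-1 : R) N, one_add_one_eq_two, neg_one_sq, mul_one,
          mul_assoc ((-1 : R) ^ N)]
        congr 3
        push_cast [Nat.cast_sub hj.le]
        simp
        ring
    · rw [Matrix.updateCol_ne (Fin.succ_ne_zero j)]
      rfl
  refine (congrArg Matrix.det h2).trans ?_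
  rw [Matrix.det_updateCol_sum]
  change (-1) ^ N * A.det = _
  rw [← hW, seqDet]
  congr 1


end ColumnOperators

theorem colOp_eq_colFunctional (m : ℕ) (p : SymFun) :
    colOp m p = colFunctional eFn m (shiftHom p) := by
  rw [colOp, colFunctional, Polynomial.lsum_apply, Polynomial.sum,
    finsum_eq_sum_of_support_subset (s := (shiftHom p).support)]
  · refine Finset.sum_congr rfl fun n _ => ?_
    rw [coeff_shiftHom, LinearMap.smul_apply, LinearMap.id_apply, smul_eq_mul, smul_mul_assoc]
  · intro n hn
    rw [Finset.mem_coe, Polynomial.mem_support_iff, coeff_shiftHom]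
    intro H
    rw [Function.mem_support, H, mul_zero, smul_zero] at hn
    exact hn rfl

theorem colOp_seqDet_eFn (N : ℕ) (b : ℕ → ℕ) :
    colOp (b 0) (seqDet eFn N fun i => b (i + 1)) = seqDet eFn (N + 1) b := by
  rw [colOp_eq_colFunctional]
  exact colFunctional_map_seqDet_of_elementary (T := (shiftHom : SymFun →+* SymFun[X])) eFn_zero
    shiftHom_eFn_succ N b

theorem colOp_seqDet_hFn (N : ℕ) (a : ℕ → ℕ) :
    colOp (N + 1) (seqDet hFn (N + 1) a) = seqDet hFn (N + 1) fun i => a i + 1 := by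
  rw [colOp_eq_colFunctional]
  exact colFunctional_map_seqDet_of_complete (T := (shiftHom : SymFun →+* SymFun[X])) eFn_zero
    hFn_zero shiftHom_hFn sum_eFn_mul_hFn N a

/-! ### Schur functions -/

theorem foldr_colOp_eq_seqDet_eFn (c : List ℕ) :
    c.foldr colOp 1 = seqDet eFn c.length fun i => c.getD i 0 := by
  induction c with
  | nil => exact (Matrix.det_isEmpty (n := Fin 0)).symm
  | cons m c ih => rw [List.foldr_cons, ih, List.length_cons, ← colOp_seqDet_eFn]; rfl

theorem foldr_colOp_eq_seqDet_hFn (c : List ℕ) (hc : c.Pairwise (· ≥ ·)) (hpos : ∀ x ∈ c, 0 < x)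
    {N : ℕ} (hN : ∀ x ∈ c, x ≤ N) :
    c.foldr colOp 1 = seqDet hFn N fun i => c.countP fun m => decide (i < m) := by
  induction c generalizing N with
  | nil =>
    rw [seqDet_eq_of_le hFn_zero (Nat.zero_le N) fun i _ => List.countP_nil]
    exact (Matrix.det_isEmpty).symm
  | cons m c ih =>
    rw [List.pairwise_cons] at hc
    have hm : 0 < m := hpos m List.mem_cons_self
    rw [seqDet_eq_of_le hFn_zero (hN m List.mem_cons_self), List.foldr_cons,
      ih hc.2 (fun x hx => hpos x (List.mem_cons_of_mem _ hx)) (N := m) hc.1]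
    · obtain ⟨l, rfl⟩ := Nat.exists_eq_succ_of_ne_zero hm.ne'
      rw [Nat.succ_eq_add_one, colOp_seqDet_hFn]
      refine seqDet_congr _ _ fun i hi => ?_
      rw [List.countP_cons_of_pos (by simpa using hi)]
    · intro i hi
      rw [List.countP_eq_zero]
      intro x hx
      have : x ≤ m := by
        rcases List.mem_cons.1 hx with rfl | hx
        · exact le_rfl
        · exact hc.1 x hx
      simp
      omega

theorem countP_range_lt (n a : ℕ) : ((List.range n).countP fun j => decide (j < a)) = min n a := by
  induction n with
  | zero => simp
  | succ n ih =>
    rw [List.range_succ, List.countP_append, ih, List.countP_singleton]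
    split_ifs with h <;> simp at h <;> omega

/-- The Schur function is obtained by applying the column operators to `1`. -/
theorem schur_eq_foldr_colOp (lam : YoungDiagram) :
    schur lam = lam.transpose.rowLens.foldr colOp 1 := by
  rw [foldr_colOp_eq_seqDet_hFn _ lam.transpose.rowLens_sorted.pairwise
    lam.transpose.pos_of_mem_rowLens (N := lam.colLen 0)]
  · rw [schur, rowDet_eq_seqDet]
    refine seqDet_congr _ _ fun i _ => ?_
    rw [YoungDiagram.rowLens, List.countP_map, YoungDiagram.colLen_transpose]
    have hf : ((fun m => decide (i < m)) ∘ lam.transpose.rowLen) =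
        fun j => decide (j < lam.rowLen i) := by
      funext j
      simp only [Function.comp_apply, YoungDiagram.rowLen_transpose]
      rw [decide_eq_decide, ← YoungDiagram.mem_iff_lt_colLen, YoungDiagram.mem_iff_lt_rowLen]
    rw [hf, countP_range_lt, min_eq_right (lam.rowLen_anti 0 i (Nat.zero_le i))]
  · intro x hx
    rw [YoungDiagram.rowLens, List.mem_map] at hx
    obtain ⟨j, -, rfl⟩ := hx
    rw [YoungDiagram.rowLen_transpose]
    exact lam.colLen_anti 0 j (Nat.zero_le j)

/-- The dual Jacobi–Trudi formula. -/
theorem schur_eq_rowDet_eFn (lam : YoungDiagram) : schur lam = rowDet eFn lam.transpose := by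
  rw [schur_eq_foldr_colOp, foldr_colOp_eq_seqDet_eFn, rowDet_eq_seqDet,
    YoungDiagram.length_rowLens]
  refine seqDet_congr _ _ fun i hi => ?_
  rw [List.getD_eq_getElem _ _ (by rwa [YoungDiagram.length_rowLens])]
  exact YoungDiagram.get_rowLens

/-! ### Orthonormality of the Schur functions -/

theorem injective_succ_fst : Function.Injective fun c : ℕ × ℕ => (c.1 + 1, c.2) := by
  intro a b h
  obtain ⟨h1, h2⟩ := Prod.mk.inj h
  exact Prod.ext (by omega) h2

/-- The diagram `lam` without its first row. -/
def dropRow (lam : YoungDiagram) : YoungDiagram where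
  cells := lam.cells.preimage _ injective_succ_fst.injOn
  isLowerSet := by
    rintro ⟨i, j⟩ ⟨k, l⟩ hle h
    obtain ⟨h1, h2⟩ := Prod.mk_le_mk.1 hle
    have h' : (i + 1, j) ∈ lam.cells :=
      (Finset.mem_preimage (hf := injective_succ_fst.injOn)).1 (Finset.mem_coe.1 h)
    exact Finset.mem_coe.2 (Finset.mem_preimage.2 (lam.up_left_mem (Nat.succ_le_succ h1) h2 h'))

theorem mem_dropRow {lam : YoungDiagram} {i j : ℕ} :
    (i, j) ∈ dropRow lam ↔ (i + 1, j) ∈ lam :=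
  Finset.mem_preimage (hf := injective_succ_fst.injOn)

theorem rowLen_dropRow (lam : YoungDiagram) (i : ℕ) :
    (dropRow lam).rowLen i = lam.rowLen (i + 1) :=
  eq_of_forall_lt_iff fun j => by
    rw [← YoungDiagram.mem_iff_lt_rowLen, mem_dropRow, YoungDiagram.mem_iff_lt_rowLen]

theorem colLen_dropRow (lam : YoungDiagram) (j : ℕ) :
    (dropRow lam).colLen j = lam.colLen j - 1 :=
  eq_of_forall_lt_iff fun i => by
    rw [← YoungDiagram.mem_iff_lt_colLen, mem_dropRow, YoungDiagram.mem_iff_lt_colLen]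
    omega

theorem colLen_pos_iff {lam : YoungDiagram} {j : ℕ} : 0 < lam.colLen j ↔ j < lam.rowLen 0 := by
  rw [← YoungDiagram.mem_iff_lt_colLen, YoungDiagram.mem_iff_lt_rowLen]

theorem rowLen_pos_iff {lam : YoungDiagram} {i : ℕ} : 0 < lam.rowLen i ↔ i < lam.colLen 0 := by
  rw [← YoungDiagram.mem_iff_lt_rowLen, YoungDiagram.mem_iff_lt_colLen]

theorem eq_of_rowLen_eq {lam mu : YoungDiagram} (h : ∀ i, lam.rowLen i = mu.rowLen i) :
    lam = mu := by
  refine YoungDiagram.ext (Finset.ext ?_)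
  rintro ⟨i, j⟩
  rw [YoungDiagram.mem_cells, YoungDiagram.mem_cells, YoungDiagram.mem_iff_lt_rowLen,
    YoungDiagram.mem_iff_lt_rowLen, h]

theorem eq_of_dropRow_eq {lam mu : YoungDiagram} (h0 : lam.rowLen 0 = mu.rowLen 0)
    (h : dropRow lam = dropRow mu) : lam = mu := by
  refine eq_of_rowLen_eq fun i => ?_
  cases i with
  | zero => exact h0
  | succ i => rw [← rowLen_dropRow, h, rowLen_dropRow]

theorem map_seqDet_of_elementary {R : Type*} [CommRing R] {e : ℕ → R} {T : R →+* R[X]}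
    (he0 : e 0 = 1)
    (hTe : ∀ n, T (e (n + 1)) = Polynomial.C (e (n + 1)) + Polynomial.X * Polynomial.C (e n))
    (N : ℕ) (c : ℕ → ℕ) : T (seqDet e N c) = ((Polynomial.X : R[X]) •
      (Matrix.of fun i j : Fin N => extZ e ((c i : ℤ) + (j : ℤ) - (i : ℤ) - 1)).map Polynomial.C +
      (Matrix.of fun i j : Fin N => extZ e ((c i : ℤ) + (j : ℤ) - (i : ℤ))).map
        Polynomial.C).det := by
  rw [seqDet, RingHom.map_det]
  congr 1
  ext1 i j
  change T (extZ e _) = Polynomial.X * Polynomial.C (extZ e _) + Polynomial.C (extZ e _)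
  rw [map_extZ_of_elementary he0 hTe, add_comm]

theorem schur_eq_seqDet_eFn (lam : YoungDiagram) :
    schur lam = seqDet eFn (lam.rowLen 0) lam.colLen := by
  rw [schur_eq_rowDet_eFn, rowDet_eq_seqDet, YoungDiagram.colLen_transpose]
  exact seqDet_congr _ _ fun i _ => YoungDiagram.rowLen_transpose _ _

theorem shiftCoeff_schur_eq_zero (lam : YoungDiagram) {m : ℕ} (hm : lam.rowLen 0 < m) :
    shiftCoeff m (schur lam) = 0 := by
  rw [← coeff_shiftHom, schur_eq_seqDet_eFn]
  have h := map_seqDet_of_elementary (T := (shiftHom : SymFun →+* SymFun[X])) eFn_zero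
    shiftHom_eFn_succ (lam.rowLen 0) lam.colLen
  rw [RingHom.coe_coe] at h
  rw [h]
  refine Polynomial.coeff_eq_zero_of_natDegree_lt (lt_of_le_of_lt
    (Polynomial.natDegree_det_X_add_C_le _ _) ?_)
  rwa [Fintype.card_fin]

theorem shiftCoeff_rowLen_zero_schur (lam : YoungDiagram) :
    shiftCoeff (lam.rowLen 0) (schur lam) = schur (dropRow lam) := by
  rw [← coeff_shiftHom, schur_eq_seqDet_eFn]
  have h := map_seqDet_of_elementary (T := (shiftHom : SymFun →+* SymFun[X])) eFn_zero
    shiftHom_eFn_succ (lam.rowLen 0) lam.colLen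
  rw [RingHom.coe_coe] at h
  have h2 := Polynomial.coeff_det_X_add_C_card
    (Matrix.of fun i j : Fin (lam.rowLen 0) => extZ eFn ((lam.colLen i : ℤ) + (j : ℤ) - (i : ℤ) - 1))
    (Matrix.of fun i j : Fin (lam.rowLen 0) => extZ eFn ((lam.colLen i : ℤ) + (j : ℤ) - (i : ℤ)))
  rw [Fintype.card_fin] at h2
  rw [h, h2, schur_eq_rowDet_eFn, rowDet_eq_seqDet_of_le eFn_zero _ (N := lam.rowLen 0), seqDet]
  · congr 1
    ext1 i j
    rw [Matrix.of_apply, Matrix.of_apply]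
    congr 1
    rw [YoungDiagram.rowLen_transpose, colLen_dropRow]
    have := colLen_pos_iff.2 i.2
    omega
  · rw [YoungDiagram.colLen_transpose, rowLen_dropRow]
    exact lam.rowLen_anti 0 1 (Nat.zero_le 1)

/-- The Schur function as a polynomial in `h₁, h₂, …`. -/
def schurPoly (lam : YoungDiagram) : MvPolynomial ℕ ℚ := rowDet hVar lam

theorem hEval_schurPoly (lam : YoungDiagram) : hEval (schurPoly lam) = schur lam := by
  rw [schurPoly, rowDet_eq_seqDet, map_seqDet]
  simp only [hEval_hVar]
  rfl

theorem polyPairing_seqDet_succ (p : SymFun) (N : ℕ) (b : ℕ → ℕ)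
    (hp : ∀ m, b 0 < m → shiftCoeff m p = 0) :
    polyPairing (p : MvPowerSeries ℕ ℚ) (seqDet hVar (N + 1) b) =
      polyPairing (shiftCoeff (b 0) p : MvPowerSeries ℕ ℚ)
        (seqDet hVar N fun i => b (i + 1)) := by
  have hterm (j : Fin (N + 1)) (m : MvPolynomial ℕ ℚ) : polyPairing (p : MvPowerSeries ℕ ℚ)
      ((-1) ^ (j : ℕ) * extZ hVar ((b 0 : ℤ) + (j : ℤ) - (0 : ℕ)) * m) =
      (-1) ^ (j : ℕ) * polyPairing (shiftCoeff (b 0 + j) p : MvPowerSeries ℕ ℚ) m := by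
    have h1 : ((b 0 : ℤ) + (j : ℤ) - (0 : ℕ)) = ((b 0 + j : ℕ) : ℤ) := by push_cast; ring
    have h2 : ((-1) ^ (j : ℕ) : MvPolynomial ℕ ℚ) = MvPolynomial.C ((-1) ^ (j : ℕ)) := by simp
    rw [h1, extZ_natCast, mul_assoc, h2, ← MvPolynomial.smul_eq_C_mul, map_smul,
      polyPairing_hVar_mul, smul_eq_mul]
  rw [seqDet, Matrix.det_succ_row_zero, map_sum]
  refine (Finset.sum_congr rfl fun j _ => hterm j _).trans ?_
  rw [Fin.sum_univ_succ, Finset.sum_eq_zero, add_zero, Fin.val_zero, pow_zero, one_mul, add_zero,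
    seqDet]
  · congr 2
    ext1 i j
    change extZ hVar _ = extZ hVar _
    congr 1
    simp
    ring
  · intro j _
    rw [hp _ (by simp), ZeroMemClass.coe_zero, map_zero, LinearMap.zero_apply, mul_zero]

theorem polyPairing_one_one : polyPairing ((1 : SymFun) : MvPowerSeries ℕ ℚ) 1 = 1 := by
  have h := polyPairing_prod_hVar (1 : SymFun).2.1 0
  rw [Finsupp.prod_zero_index] at h
  rw [h]
  exact MvPowerSeries.coeff_zero_one

/-- The Schur functions are orthonormal. By symmetry of the pairing, the first row of `lam` may be
assumed to be at most as long as that of `mu`. In the expansion of the determinant `s_mu` along its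
first row, `∂_{h_m} s_lam` then vanishes for all but the first entry. -/
theorem polyPairing_schur_schurPoly [DecidableEq YoungDiagram] (lam mu : YoungDiagram) :
    polyPairing (schur lam : MvPowerSeries ℕ ℚ) (schurPoly mu) = if lam = mu then 1 else 0 := by
  have hind (n : ℕ) : ∀ lam mu : YoungDiagram, lam.colLen 0 + mu.colLen 0 ≤ n →
      polyPairing (schur lam : MvPowerSeries ℕ ℚ) (schurPoly mu) = if lam = mu then 1 else 0 := by
    induction n with
    | zero =>
      intro lam mu h
      have hrow (lam : YoungDiagram) (h : lam.colLen 0 = 0) : lam = ⊥ := by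
        refine YoungDiagram.ext (Finset.eq_empty_of_forall_notMem ?_)
        rintro ⟨i, j⟩ hc
        rw [YoungDiagram.mem_cells, YoungDiagram.mem_iff_lt_colLen] at hc
        have := lam.colLen_anti 0 j (Nat.zero_le j)
        omega
      have hdet {R : Type} [CommRing R] (s : ℕ → R) (lam : YoungDiagram) (h : lam.colLen 0 = 0) :
          rowDet s lam = 1 := by
        rw [rowDet_eq_seqDet, h]
        exact Matrix.det_isEmpty
      have h1 : lam.colLen 0 = 0 := by omega
      have h2 : mu.colLen 0 = 0 := by omega
      rw [schur, schurPoly, hdet _ _ h1, hdet _ _ h2, polyPairing_one_one,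
        if_pos ((hrow _ h1).trans (hrow _ h2).symm)]
    | succ n ih =>
      have key (lam mu : YoungDiagram) (h : lam.colLen 0 + mu.colLen 0 ≤ n + 1)
          (hle : lam.rowLen 0 ≤ mu.rowLen 0) (hpos : 0 < mu.rowLen 0) :
          polyPairing (schur lam : MvPowerSeries ℕ ℚ) (schurPoly mu) =
            if lam = mu then 1 else 0 := by
        rw [rowLen_pos_iff] at hpos
        obtain ⟨N, hN⟩ := Nat.exists_eq_succ_of_ne_zero hpos.ne'
        have hmu : polyPairing (schur lam : MvPowerSeries ℕ ℚ) (schurPoly mu) =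
            polyPairing (shiftCoeff (mu.rowLen 0) (schur lam) : MvPowerSeries ℕ ℚ)
              (schurPoly (dropRow mu)) := by
          rw [schurPoly, rowDet_eq_seqDet, hN, polyPairing_seqDet_succ, schurPoly, rowDet_eq_seqDet,
            colLen_dropRow, hN]
          · congr 1
            exact seqDet_congr _ _ fun i _ => (rowLen_dropRow mu i).symm
          · intro m hm
            exact shiftCoeff_schur_eq_zero _ (lt_of_le_of_lt hle hm)
        rw [hmu]
        rcases hle.lt_or_eq with hlt | heq
        · rw [shiftCoeff_schur_eq_zero _ hlt, ZeroMemClass.coe_zero, map_zero,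
            LinearMap.zero_apply, if_neg]
          rintro rfl
          exact hlt.false
        · rw [← heq, shiftCoeff_rowLen_zero_schur, ih _ _ (by
            rw [colLen_dropRow, colLen_dropRow]; omega)]
          exact if_congr ⟨eq_of_dropRow_eq heq, congrArg _⟩ rfl rfl
      intro lam mu h
      rcases Nat.eq_zero_or_pos (lam.colLen 0 + mu.colLen 0) with h0 | h0
      · exact ih _ _ (by omega)
      · rw [gt_iff_lt, Nat.add_pos_iff_pos_or_pos, ← rowLen_pos_iff, ← rowLen_pos_iff] at h0
        rcases le_total (lam.rowLen 0) (mu.rowLen 0) with hle | hle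
        · exact key _ _ h hle (by omega)
        · rw [← hEval_schurPoly, polyPairing_hEval_comm, hEval_schurPoly,
            key _ _ (by omega) hle (by omega)]
          exact if_congr eq_comm rfl rfl
  exact hind _ lam mu le_rfl

/-! ### The Schur functions span -/

/-- The composition with parts `α 0, …, α (N - 1)`. -/
def finComp {N : ℕ} (α : Fin N → ℕ) : ℕ →₀ ℕ :=
  Finsupp.onFinset (Finset.range N) (fun i => if h : i < N then α ⟨i, h⟩ else 0) fun i hi => by
    by_contra H
    rw [Finset.mem_range] at H
    rw [dif_neg H] at hi
    exact hi rfl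

theorem finComp_apply {N : ℕ} (α : Fin N → ℕ) (i : ℕ) :
    finComp α i = if h : i < N then α ⟨i, h⟩ else 0 := rfl

theorem prod_finComp {M : Type*} [CommMonoid M] (φ : ℕ → M) (h0 : φ 0 = 1) {N : ℕ}
    (α : Fin N → ℕ) : ((finComp α).prod fun _ => φ) = ∏ i, φ (α i) := by
  rw [Finsupp.prod_of_support_subset (finComp α) Finsupp.support_onFinset_subset _ fun _ _ => h0,
    Finset.prod_range]
  refine Finset.prod_congr rfl fun i _ => ?_
  rw [finComp_apply, dif_pos i.2]

/-- The sum of the squares of the parts of a composition. -/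
def sqSum (d : ℕ →₀ ℕ) : ℕ := d.sum fun _ k => k ^ 2

theorem sqSum_finComp {N : ℕ} (α : Fin N → ℕ) : sqSum (finComp α) = ∑ i, α i ^ 2 :=
  prod_finComp (M := Multiplicative ℕ) (fun k => Multiplicative.ofAdd (k ^ 2)) rfl α

theorem sqSum_mapDomain (σ : Equiv.Perm ℕ) (d : ℕ →₀ ℕ) : sqSum (d.mapDomain σ) = sqSum d :=
  Finsupp.sum_mapDomain_index_inj σ.injective

theorem sqSum_le (d : ℕ →₀ ℕ) : sqSum d ≤ d.degree ^ 2 := by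
  have h (i : ℕ) : d i ≤ d.degree := Finsupp.le_degree i d
  calc sqSum d ≤ ∑ i ∈ d.support, d i * d.degree :=
        Finset.sum_le_sum fun i _ => (sq (d i)).trans_le (Nat.mul_le_mul_left _ (h i))
    _ = d.degree ^ 2 := by rw [← Finset.sum_mul, sq]; rfl

/-- The exponents `aᵢ + σ(i) - i` in the Jacobi–Trudi determinant have a larger sum of squares than
the parts of the partition `a` itself, by the rearrangement inequality. -/
theorem sum_sq_add_le {N : ℕ} {a : ℕ → ℕ} (ha : Antitone a) (σ : Equiv.Perm (Fin N)) :
    ∑ i : Fin N, (a i : ℤ) ^ 2 + ∑ i : Fin N, ((σ i : ℤ) - (i : ℤ)) ^ 2 ≤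
      ∑ i : Fin N, ((a i : ℤ) + (σ i : ℤ) - (i : ℤ)) ^ 2 := by
  have h : ∑ i : Fin N, (a i : ℤ) * (i : ℤ) ≤ ∑ i : Fin N, (a i : ℤ) * (σ i : ℤ) := by
    refine Antivary.sum_mul_le_sum_mul_comp_perm (f := fun i : Fin N => (a i : ℤ))
      (g := fun i : Fin N => (i : ℤ)) ?_
    intro i j hij
    have hij' : (i : ℕ) ≤ j := by
      have : ((i : ℕ) : ℤ) < (j : ℕ) := hij
      omega
    exact Int.ofNat_le.2 (ha hij')
  have h2 : ∑ i : Fin N, ((a i : ℤ) + (σ i : ℤ) - (i : ℤ)) ^ 2 = (∑ i : Fin N, (a i : ℤ) ^ 2 +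
      ∑ i : Fin N, ((σ i : ℤ) - (i : ℤ)) ^ 2) + 2 * (∑ i : Fin N, (a i : ℤ) * (σ i : ℤ) -
        ∑ i : Fin N, (a i : ℤ) * (i : ℤ)) := by
    rw [← Finset.sum_sub_distrib, Finset.mul_sum, ← Finset.sum_add_distrib,
      ← Finset.sum_add_distrib]
    exact Finset.sum_congr rfl fun i _ => by ring
  linarith

theorem polyPairing_prod_extZ {w : MvPowerSeries ℕ ℚ} (hw : w ∈ SymSeries) {N : ℕ} (α : Fin N → ℤ)
    (hα : ∀ i, 0 ≤ α i) : polyPairing w (∏ i, extZ hVar (α i)) =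
      MvPowerSeries.coeff (finComp fun i => (α i).toNat) w := by
  rw [← polyPairing_prod_hVar hw, prod_finComp _ hVar_zero]
  congr 1
  refine Finset.prod_congr rfl fun i _ => ?_
  conv_lhs => rw [← Int.toNat_of_nonneg (hα i)]
  rfl

/-- For a partition `a` whose sum of squares is at least that of all the exponents of `w`, only the
diagonal term of the Jacobi–Trudi determinant contributes to the pairing with `w`. -/
theorem polyPairing_seqDet_eq_coeff {w : MvPowerSeries ℕ ℚ} (hw : w ∈ SymSeries) {Q : ℕ}
    (hQ : ∀ d, Q < sqSum d → MvPowerSeries.coeff d w = 0) (N : ℕ) {a : ℕ → ℕ} (ha : Antitone a)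
    (haQ : Q ≤ ∑ i : Fin N, a i ^ 2) : polyPairing w (seqDet hVar N a) =
      MvPowerSeries.coeff (finComp fun i : Fin N => a i) w := by
  rw [seqDet, ← Matrix.det_transpose, Matrix.det_apply, map_sum, Finset.sum_eq_single 1]
  · rw [Equiv.Perm.sign_one, one_smul]
    have h := polyPairing_prod_extZ hw (fun i : Fin N => (a i : ℤ)) fun i => by positivity
    simp only [Int.toNat_natCast] at h
    rw [← h]
    congr 1
    refine Finset.prod_congr rfl fun i _ => ?_
    change extZ hVar ((a i : ℤ) + (i : ℤ) - (i : ℤ)) = _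
    rw [add_sub_cancel_right]
  · intro σ _ hσ
    rw [Units.smul_def, map_zsmul]
    have h0 : polyPairing w (∏ i : Fin N, extZ hVar ((a i : ℤ) + (σ i : ℤ) - (i : ℤ))) = 0 := by
      by_cases hneg : ∀ i : Fin N, 0 ≤ (a i : ℤ) + (σ i : ℤ) - (i : ℤ)
      · rw [polyPairing_prod_extZ hw _ hneg]
        refine hQ _ ?_
        rw [sqSum_finComp]
        have h1 := sum_sq_add_le ha σ
        have h2 : 0 < ∑ i : Fin N, ((σ i : ℤ) - (i : ℤ)) ^ 2 := by
          obtain ⟨i, hi⟩ := not_forall.1 fun H => hσ (Equiv.ext H)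
          refine Finset.sum_pos' (fun i _ => sq_nonneg _) ⟨i, Finset.mem_univ i, ?_⟩
          refine sq_pos_of_ne_zero ?_
          intro H
          refine hi (Fin.ext ?_)
          change ((σ i : Fin N) : ℕ) = (i : ℕ)
          omega
        have h3 : (Q : ℤ) ≤ ∑ i : Fin N, (a i : ℤ) ^ 2 := by exact_mod_cast haQ
        zify
        simp only [Int.toNat_of_nonneg (hneg _)]
        omega
      · push Not at hneg
        obtain ⟨i, hi⟩ := hneg
        rw [Finset.prod_eq_zero (Finset.mem_univ i) (extZ_of_neg _ hi), map_zero]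
    refine (congrArg _ h0).trans (smul_zero _)
  · intro H
    exact absurd (Finset.mem_univ _) H

/-- The diagram with rows `d 0 ≥ d 1 ≥ ⋯`. -/
def diagramOfRows (d : ℕ →₀ ℕ) (hd : Antitone d) : YoungDiagram where
  cells := (d.support ×ˢ Finset.range d.degree).filter fun c => c.2 < d c.1
  isLowerSet := by
    rintro ⟨i, j⟩ ⟨k, l⟩ hle h
    obtain ⟨h1, h2⟩ := Prod.mk_le_mk.1 hle
    rw [Finset.mem_coe, Finset.mem_filter] at h ⊢
    have h3 : j < d i := h.2
    have h4 : l < d k := h2.trans_lt (h3.trans_le (hd h1))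
    refine ⟨Finset.mem_product.2 ⟨?_, ?_⟩, h4⟩
    · rw [Finsupp.mem_support_iff]
      exact (Nat.zero_le l).trans_lt h4 |>.ne'
    · rw [Finset.mem_range]
      exact h4.trans_le (Finsupp.le_degree k d)

theorem rowLen_diagramOfRows (d : ℕ →₀ ℕ) (hd : Antitone d) (i : ℕ) :
    (diagramOfRows d hd).rowLen i = d i := by
  refine eq_of_forall_lt_iff fun j => ?_
  rw [← YoungDiagram.mem_iff_lt_rowLen, ← YoungDiagram.mem_cells, diagramOfRows, Finset.mem_filter,
    Finset.mem_product, Finsupp.mem_support_iff, Finset.mem_range]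
  refine ⟨fun h => h.2, fun h => ⟨⟨?_, h.trans_le (Finsupp.le_degree i d)⟩, h⟩⟩
  change d i ≠ 0
  omega

theorem finComp_rowLen_diagramOfRows (d : ℕ →₀ ℕ) (hd : Antitone d) :
    (finComp fun i : Fin ((diagramOfRows d hd).colLen 0) => (diagramOfRows d hd).rowLen i) = d := by
  ext i
  rw [finComp_apply]
  split_ifs with h
  · exact rowLen_diagramOfRows d hd i
  · rw [← rowLen_pos_iff, rowLen_diagramOfRows] at h
    omega

/-- A family of compositions closed under permutations contains a partition. It is a member that
minimizes `∑ i dᵢ`. -/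
theorem exists_antitone_of_perm_closed {S : Set (ℕ →₀ ℕ)} (hS : S.Nonempty)
    (hperm : ∀ d ∈ S, ∀ σ : Equiv.Perm ℕ, d.mapDomain σ ∈ S) : ∃ d ∈ S, Antitone d := by
  let ω : (ℕ →₀ ℕ) → ℕ := fun d => d.sum fun i k => i * k
  obtain ⟨d, hd, hmin⟩ := (measure ω).wf.has_min S hS
  refine ⟨d, hd, antitone_nat_of_succ_le fun i => ?_⟩
  by_contra hlt
  push Not at hlt
  refine hmin _ (hperm d hd (Equiv.swap i (i + 1))) ?_
  change ω (d.mapDomain (Equiv.swap i (i + 1))) < ω d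
  have h1 : ω (d.mapDomain (Equiv.swap i (i + 1))) =
      d.sum fun j k => Equiv.swap i (i + 1) j * k :=
    Finsupp.sum_mapDomain_index (fun _ => mul_zero _) fun _ _ _ => mul_add _ _ _
  have hsub : d.support ⊆ insert i (insert (i + 1) d.support) := fun j hj =>
    Finset.mem_insert_of_mem (Finset.mem_insert_of_mem hj)
  rw [Finsupp.sum_of_support_subset d hsub _ fun _ _ => mul_zero _] at h1
  have h2 : ω d = ∑ j ∈ insert i (insert (i + 1) d.support), j * d j :=
    Finsupp.sum_of_support_subset d hsub _ fun _ _ => mul_zero _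
  have h3 : ω d + d i = ω (d.mapDomain (Equiv.swap i (i + 1))) + d (i + 1) := by
    calc ω d + d i = ∑ j ∈ insert i (insert (i + 1) d.support),
          (j * d j + if j = i then d j else 0) := by
          rw [Finset.sum_add_distrib, Finset.sum_ite_eq' _ i, if_pos (by simp), h2]
      _ = ∑ j ∈ insert i (insert (i + 1) d.support),
          (Equiv.swap i (i + 1) j * d j + if j = i + 1 then d j else 0) := by
          refine Finset.sum_congr rfl fun j _ => ?_
          by_cases hj : j = i
          · subst hj
            rw [if_pos rfl, Equiv.swap_apply_left, if_neg (by omega)]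
            ring
          · by_cases hj' : j = i + 1
            · subst hj'
              rw [if_neg hj, if_pos rfl, Equiv.swap_apply_right]
              ring
            · rw [if_neg hj, if_neg hj', Equiv.swap_apply_of_ne_of_ne hj hj']
      _ = _ := by rw [Finset.sum_add_distrib, Finset.sum_ite_eq' _ (i + 1), if_pos (by simp), h1]
  omega

theorem exists_sqSum_bound (p : SymFun) :
    ∃ Q, ∀ d, Q < sqSum d → MvPowerSeries.coeff d (p : MvPowerSeries ℕ ℚ) = 0 := by
  obtain ⟨N, hN⟩ := p.2.2
  refine ⟨N ^ 2, fun d hd => hN d ?_⟩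
  exact lt_of_pow_lt_pow_left₀ 2 (Nat.zero_le _) (hd.trans_le (sqSum_le d))

/-- A symmetric function orthogonal to all Schur functions is zero. Otherwise, among the exponents
with nonzero coefficient, one with the largest sum of squares can be taken to be a partition, and
its coefficient is the pairing with the Schur function. -/
theorem eq_zero_of_polyPairing_schurPoly (p : SymFun)
    (hp : ∀ lam, polyPairing (p : MvPowerSeries ℕ ℚ) (schurPoly lam) = 0) : p = 0 := by
  by_contra hne
  obtain ⟨N, hN⟩ := exists_sqSum_bound p
  let V : Set ℕ := {q | ∃ d, sqSum d = q ∧ MvPowerSeries.coeff d (p : MvPowerSeries ℕ ℚ) ≠ 0}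
  have hV : V.Nonempty := by
    by_contra H
    refine hne (symFun_ext fun d => ?_)
    by_contra hd
    exact H ⟨_, d, rfl, hd⟩
  have hbdd : BddAbove V := by
    refine ⟨N, ?_⟩
    rintro q ⟨d, rfl, hd⟩
    by_contra H
    exact hd (hN d (not_le.1 H))
  have hmem := Nat.sSup_mem hV hbdd
  obtain ⟨d, ⟨hd1, hd2⟩, hd⟩ := exists_antitone_of_perm_closed
    (S := {d | sqSum d = sSup V ∧ MvPowerSeries.coeff d (p : MvPowerSeries ℕ ℚ) ≠ 0}) hmem (by
      rintro d ⟨h1, h2⟩ σ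
      refine ⟨?_, ?_⟩
      · rw [sqSum_mapDomain, h1]
      · rwa [coeff_mapDomain_of_mem p.2.1])
  refine hd2 ?_
  have h := polyPairing_seqDet_eq_coeff p.2.1 (Q := sSup V) (fun e he => ?_)
    ((diagramOfRows d hd).colLen 0) (a := (diagramOfRows d hd).rowLen)
    (fun i j hij => (diagramOfRows d hd).rowLen_anti i j hij) ?_
  · rw [finComp_rowLen_diagramOfRows] at h
    rw [← h]
    exact hp _
  · by_contra H
    exact absurd (le_csSup hbdd ⟨e, rfl, H⟩) (not_le.2 he)
  · rw [← sqSum_finComp, finComp_rowLen_diagramOfRows, hd1]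

/-- The sum of the squares of the rows of a diagram. -/
def rowSqSum (lam : YoungDiagram) : ℕ := ∑ i : Fin (lam.colLen 0), lam.rowLen i ^ 2

theorem finite_rowSqSum_le (Q : ℕ) : {lam : YoungDiagram | rowSqSum lam ≤ Q}.Finite := by
  refine Set.Finite.subset (s := YoungDiagram.cells ⁻¹'
    ((Finset.range Q ×ˢ Finset.range Q).powerset : Set (Finset (ℕ × ℕ))))
    ((Finset.finite_toSet _).preimage fun a _ b _ h => YoungDiagram.ext h) ?_
  intro lam hlam
  have hlam' : rowSqSum lam ≤ Q := hlam
  refine Set.mem_preimage.2 (Finset.mem_coe.2 (Finset.mem_powerset.2 ?_))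
  rintro ⟨i, j⟩ hij
  rw [YoungDiagram.mem_cells] at hij
  have hi : i < lam.colLen 0 := rowLen_pos_iff.1 (by
    rw [YoungDiagram.mem_iff_lt_rowLen] at hij; omega)
  have hj := YoungDiagram.mem_iff_lt_rowLen.1 hij
  have h1 : lam.colLen 0 ≤ rowSqSum lam := by
    calc lam.colLen 0 = ∑ i : Fin (lam.colLen 0), 1 := by simp
      _ ≤ _ := Finset.sum_le_sum fun i _ => Nat.one_le_pow _ _ (rowLen_pos_iff.2 i.2)
  have h2 : lam.rowLen i ≤ rowSqSum lam :=
    (Nat.le_self_pow two_ne_zero _).trans (Finset.single_le_sum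
      (f := fun i : Fin (lam.colLen 0) => lam.rowLen i ^ 2) (fun _ _ => Nat.zero_le _)
      (Finset.mem_univ ⟨i, hi⟩))
  rw [Finset.mem_product, Finset.mem_range, Finset.mem_range]
  omega

theorem polyPairing_schurPoly_eq_zero {p : SymFun} {Q : ℕ}
    (hQ : ∀ d, Q < sqSum d → MvPowerSeries.coeff d (p : MvPowerSeries ℕ ℚ) = 0)
    {lam : YoungDiagram} (hlam : Q < rowSqSum lam) :
    polyPairing (p : MvPowerSeries ℕ ℚ) (schurPoly lam) = 0 := by
  have h := polyPairing_seqDet_eq_coeff p.2.1 hQ (lam.colLen 0) (a := lam.rowLen)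
    (fun i j hij => lam.rowLen_anti i j hij) hlam.le
  rw [schurPoly, rowDet_eq_seqDet, h]
  refine hQ _ ?_
  rwa [sqSum_finComp]

theorem polyPairing_coe_sum {ι : Type*} (s : Finset ι) (a : ι → ℚ) (p : ι → SymFun)
    (F : MvPolynomial ℕ ℚ) :
    polyPairing ((∑ i ∈ s, a i • p i : SymFun) : MvPowerSeries ℕ ℚ) F =
      ∑ i ∈ s, a i * polyPairing (p i : MvPowerSeries ℕ ℚ) F := by
  rw [AddSubmonoidClass.coe_finsetSum, map_sum, LinearMap.sum_apply]
  refine Finset.sum_congr rfl fun i _ => ?_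
  rw [← smul_eq_mul, ← LinearMap.smul_apply, ← map_smul]
  rfl

theorem span_range_schur : Submodule.span ℚ (Set.range schur) = ⊤ := by
  classical
  refine eq_top_iff.2 fun p _ => ?_
  obtain ⟨Q, hQ⟩ := exists_sqSum_bound p
  let S := (finite_rowSqSum_le Q).toFinset
  let p' : SymFun := ∑ lam ∈ S, polyPairing (p : MvPowerSeries ℕ ℚ) (schurPoly lam) • schur lam
  have hp : p = p' := by
    rw [← sub_eq_zero]
    refine eq_zero_of_polyPairing_schurPoly _ fun mu => ?_
    have h1 : polyPairing ((p - p' : SymFun) : MvPowerSeries ℕ ℚ) (schurPoly mu) =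
        polyPairing (p : MvPowerSeries ℕ ℚ) (schurPoly mu) -
          polyPairing (p' : MvPowerSeries ℕ ℚ) (schurPoly mu) := by
      rw [AddSubgroupClass.coe_sub, map_sub, LinearMap.sub_apply]
    rw [h1, polyPairing_coe_sum]
    simp only [polyPairing_schur_schurPoly, mul_ite, mul_one, mul_zero]
    rw [Finset.sum_ite_eq' S mu]
    split_ifs with hmu
    · exact sub_self _
    · rw [sub_zero]
      refine polyPairing_schurPoly_eq_zero hQ ?_
      by_contra H
      exact hmu ((finite_rowSqSum_le Q).mem_toFinset.2 (not_lt.1 H))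
  rw [hp]
  exact Submodule.sum_mem _ fun lam _ => Submodule.smul_mem _ _
    (Submodule.subset_span ⟨lam, rfl⟩)

theorem linearIndependent_schur : LinearIndependent ℚ schur := by
  classical
  rw [linearIndependent_iff']
  intro s a h mu hmu
  have h1 := polyPairing_coe_sum s a schur (schurPoly mu)
  rw [h, ZeroMemClass.coe_zero, map_zero, LinearMap.zero_apply] at h1
  simp only [polyPairing_schur_schurPoly, mul_ite, mul_one, mul_zero] at h1
  rw [Finset.sum_ite_eq' s mu, if_pos hmu] at h1
  exact h1.symm

/-- The basis of Schur functions. -/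
def schurBasis : Module.Basis YoungDiagram ℚ SymFun :=
  Module.Basis.mk linearIndependent_schur span_range_schur.ge

theorem schurBasis_apply (lam : YoungDiagram) : schurBasis lam = schur lam :=
  Module.Basis.mk_apply _ _ lam

/-! ### The complete functions are free generators, and the Hall pairing -/

theorem hEval_surjective : Function.Surjective hEval := by
  rw [← AlgHom.coe_toLinearMap, ← LinearMap.range_eq_top, eq_top_iff, ← span_range_schur,
    Submodule.span_le]
  rintro _ ⟨lam, rfl⟩
  exact ⟨schurPoly lam, hEval_schurPoly lam⟩

theorem partMult_mapDomain (σ : Equiv.Perm ℕ) (d : ℕ →₀ ℕ) :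
    partMult (d.mapDomain σ) = partMult d :=
  Finsupp.sum_mapDomain_index_inj σ.injective

/-- The monomial symmetric function, the sum of all monomials with the given multiplicities of the
exponents. -/
def monomialFn (m : ℕ →₀ ℕ) : SymFun :=
  ⟨(fun d => open Classical in if partMult d = m then 1 else 0 : (ℕ →₀ ℕ) → ℚ), by
    classical
    obtain ⟨d₀, hd₀⟩ := exists_partMult_eq m
    refine ⟨mem_symSeries_of_coeff fun σ d => ?_, d₀.degree, fun d hd => if_neg ?_⟩
    · change (if partMult (d.mapDomain σ) = m then (1 : ℚ) else 0) = if partMult d = m then 1 else 0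
      rw [partMult_mapDomain]
    · intro h
      obtain ⟨σ, rfl⟩ := exists_perm_of_partMult_eq (hd₀.trans h.symm)
      rw [Finsupp.degree_mapDomain] at hd
      exact hd.false⟩

theorem polyPairing_monomialFn (m : ℕ →₀ ℕ) (F : MvPolynomial ℕ ℚ) :
    polyPairing (monomialFn m : MvPowerSeries ℕ ℚ) F = MvPolynomial.coeff m F := by
  classical
  have h : polyPairing (monomialFn m : MvPowerSeries ℕ ℚ) = MvPolynomial.lcoeff ℚ m := by
    refine linearMap_ext_prod_hVar fun d => ?_
    rw [polyPairing_prod_hVar (monomialFn m).2.1, prod_hVar, MvPolynomial.lcoeff_apply,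
      MvPolynomial.coeff_monomial]
    rfl
  rw [h, MvPolynomial.lcoeff_apply]

/-- The `h_n` are algebraically independent: by symmetry, an element of the kernel is orthogonal to
all symmetric functions. -/
theorem hEval_injective : Function.Injective hEval := by
  rw [injective_iff_map_eq_zero]
  intro F hF
  ext m
  obtain ⟨G, hG⟩ := hEval_surjective (monomialFn m)
  rw [← polyPairing_monomialFn, ← hG, polyPairing_hEval_comm, hF, ZeroMemClass.coe_zero, map_zero,
    LinearMap.zero_apply, MvPolynomial.coeff_zero]

/-- `Λ` is the polynomial ring in `h₁, h₂, …`. -/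
def hEquiv : MvPolynomial ℕ ℚ ≃ₐ[ℚ] SymFun :=
  AlgEquiv.ofBijective hEval ⟨hEval_injective, hEval_surjective⟩

theorem hEquiv_symm_hFn (n : ℕ) : hEquiv.symm (hFn n) = hVar n := by
  rw [AlgEquiv.symm_apply_eq]
  exact (hEval_hVar n).symm

theorem hEquiv_symm_hProd (d : ℕ →₀ ℕ) : hEquiv.symm (hProd d) = d.prod fun _ k => hVar k := by
  rw [AlgEquiv.symm_apply_eq]
  exact (hEval_prod_hVar d).symm

theorem linearMap_ext_hProd {M : Type*} [AddCommMonoid M] [Module ℚ M] {α β : SymFun →ₗ[ℚ] M}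
    (h : ∀ d, α (hProd d) = β (hProd d)) : α = β := by
  have h1 : α.comp hEval.toLinearMap = β.comp hEval.toLinearMap :=
    linearMap_ext_prod_hVar fun d => by
      rw [LinearMap.comp_apply, LinearMap.comp_apply, AlgHom.toLinearMap_apply, hEval_prod_hVar, h]
  ext p
  obtain ⟨F, rfl⟩ := hEval_surjective p
  exact LinearMap.congr_fun h1 F

theorem algHom_ext_hFn {B : Type*} [Semiring B] [Algebra ℚ B] {α β : SymFun →ₐ[ℚ] B}
    (h : ∀ n, α (hFn n) = β (hFn n)) : α = β := by
  have h1 : α.comp hEval = β.comp hEval := MvPolynomial.algHom_ext fun n => by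
    rw [AlgHom.comp_apply, AlgHom.comp_apply, ← hVar_succ, hEval_hVar, h]
  ext p
  obtain ⟨F, rfl⟩ := hEval_surjective p
  exact DFunLike.congr_fun h1 F

/-- The algebra map on `Λ` with prescribed values at `h₀ = 1, h₁, h₂, …`. -/
def hLift {B : Type*} [CommSemiring B] [Algebra ℚ B] (b : ℕ → B) : SymFun →ₐ[ℚ] B :=
  (MvPolynomial.aeval fun n => b (n + 1)).comp (hEquiv.symm : SymFun →ₐ[ℚ] MvPolynomial ℕ ℚ)

theorem hLift_hFn {B : Type*} [CommSemiring B] [Algebra ℚ B] {b : ℕ → B} (hb : b 0 = 1) (n : ℕ) :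
    hLift b (hFn n) = b n := by
  rw [hLift, AlgHom.comp_apply, AlgEquiv.coe_toAlgHom, hEquiv_symm_hFn]
  cases n with
  | zero => rw [hVar_zero, map_one, hb]
  | succ n => rw [hVar_succ, MvPolynomial.aeval_X]

/-- The Hall pairing of symmetric series with symmetric functions. -/
def hallPairing : SymSeries →ₗ[ℚ] SymFun →ₗ[ℚ] ℚ :=
  polyPairing.compl₁₂ SymSeries.val.toLinearMap hEquiv.symm.toLinearMap

theorem hallPairing_hProd (w : SymSeries) (d : ℕ →₀ ℕ) :
    hallPairing w (hProd d) = MvPowerSeries.coeff d (w : MvPowerSeries ℕ ℚ) := by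
  change polyPairing (w : MvPowerSeries ℕ ℚ) (hEquiv.symm (hProd d)) = _
  rw [hEquiv_symm_hProd, polyPairing_prod_hVar w.2]

theorem isHallPairing_iff (B : SymSeries →ₗ[ℚ] SymFun →ₗ[ℚ] ℚ) :
    IsHallPairing B ↔ B = hallPairing := by
  refine ⟨fun h => LinearMap.ext fun w => linearMap_ext_hProd fun d => ?_, ?_⟩
  · rw [h, hallPairing_hProd]
  · rintro rfl
    exact hallPairing_hProd

theorem hallPairing_schur [DecidableEq YoungDiagram] (lam mu : YoungDiagram) :
    hallPairing (toSeries (schur lam)) (schur mu) = if lam = mu then 1 else 0 := by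
  rw [← polyPairing_schur_schurPoly]
  change polyPairing (schur lam : MvPowerSeries ℕ ℚ) (hEquiv.symm (schur mu)) = _
  congr 1
  rw [AlgEquiv.symm_apply_eq]
  exact (hEval_schurPoly mu).symm

/-! ### Umbral operators -/

theorem coeff_pow_eq_zero_of_lt {f : ℚ⟦X⟧} (hf : PowerSeries.constantCoeff f = 0) {n k : ℕ}
    (h : n < k) : PowerSeries.coeff n (f ^ k) = 0 :=
  PowerSeries.X_pow_dvd_iff.1 (pow_dvd_pow_of_dvd (PowerSeries.X_dvd_iff.2 hf) k) n h

theorem coeff_subst_eq_sum {g : ℚ⟦X⟧} (hg : PowerSeries.constantCoeff g = 0) (φ : ℚ⟦X⟧) (n : ℕ) :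
    PowerSeries.coeff n (φ.subst g) =
      ∑ k ∈ Finset.range (n + 1), PowerSeries.coeff k φ * PowerSeries.coeff n (g ^ k) := by
  rw [PowerSeries.coeff_subst' (PowerSeries.HasSubst.of_constantCoeff_zero' hg),
    finsum_eq_sum_of_support_subset (s := Finset.range (n + 1))]
  · rfl
  · intro k hk
    by_contra H
    rw [Finset.mem_coe, Finset.mem_range] at H
    refine hk ?_
    change PowerSeries.coeff k φ • PowerSeries.coeff n (g ^ k) = 0
    rw [coeff_pow_eq_zero_of_lt hg (by omega), smul_zero]

theorem sum_coeff_pow_mul_coeff_pow {f g : ℚ⟦X⟧} (hg : PowerSeries.constantCoeff g = 0)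
    (hfg : f.subst g = (PowerSeries.X : ℚ⟦X⟧)) (j n : ℕ) :
    ∑ k ∈ Finset.range (n + 1), PowerSeries.coeff k (f ^ j) * PowerSeries.coeff n (g ^ k) =
      if n = j then 1 else 0 := by
  rw [← coeff_subst_eq_sum hg,
    PowerSeries.subst_pow (PowerSeries.HasSubst.of_constantCoeff_zero' hg), hfg,
    PowerSeries.coeff_X_pow]

/-- The umbral operator `U_f`. It maps `h_n` to `r_n = ∑_k ([z^n] f(z)^k) h_k`. -/
def umbral (f : ℚ⟦X⟧) : SymFun →ₐ[ℚ] SymFun :=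
  hLift fun n => ∑ k ∈ Finset.range (n + 1), PowerSeries.coeff n (f ^ k) • hFn k

theorem umbral_hFn (f : ℚ⟦X⟧) (n : ℕ) : umbral f (hFn n) =
    ∑ k ∈ Finset.range (n + 1), PowerSeries.coeff n (f ^ k) • hFn k := by
  refine hLift_hFn (b := fun n => ∑ k ∈ Finset.range (n + 1),
    PowerSeries.coeff n (f ^ k) • hFn k) ?_ n
  simp [hFn_zero]

theorem coe_sum_smul_hFn (n : ℕ) (a : ℕ → ℚ) (d : ℕ →₀ ℕ) :
    MvPowerSeries.coeff d ((∑ k ∈ Finset.range (n + 1), a k • hFn k : SymFun) :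
      MvPowerSeries ℕ ℚ) = if d.degree < n + 1 then a d.degree else 0 := by
  have h (k : ℕ) : MvPowerSeries.coeff d ((a k • hFn k : SymFun) : MvPowerSeries ℕ ℚ) =
      if d.degree = k then a k else 0 := by
    change MvPowerSeries.coeff d (a k • (hFn k : MvPowerSeries ℕ ℚ)) = _
    rw [map_smul, coeff_hFn, smul_eq_mul, mul_ite, mul_one, mul_zero]
  rw [AddSubmonoidClass.coe_finsetSum, map_sum]
  simp only [h]
  rw [Finset.sum_ite_eq (Finset.range (n + 1))]
  simp only [Finset.mem_range]

theorem coe_umbral_hFn {f : ℚ⟦X⟧} (hf : PowerSeries.constantCoeff f = 0) (n : ℕ) :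
    (umbral f (hFn n) : MvPowerSeries ℕ ℚ) = rFn f n := by
  ext d
  rw [umbral_hFn, coe_sum_smul_hFn n fun k => PowerSeries.coeff n (f ^ k), coeff_rFn]
  split_ifs with h
  · rfl
  · rw [coeff_pow_eq_zero_of_lt hf (by omega)]

theorem isUmbral_iff {f : ℚ⟦X⟧} (hf : PowerSeries.constantCoeff f = 0) (U : SymFun →ₐ[ℚ] SymFun) :
    IsUmbral f U ↔ U = umbral f := by
  refine ⟨fun h => algHom_ext_hFn fun n => Subtype.ext ?_, ?_⟩
  · rw [h, coe_umbral_hFn hf]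
  · rintro rfl
    exact coe_umbral_hFn hf

theorem umbral_comp_umbral {f g : ℚ⟦X⟧} (hf : PowerSeries.constantCoeff f = 0)
    (hg : PowerSeries.constantCoeff g = 0) (hfg : f.subst g = (PowerSeries.X : ℚ⟦X⟧)) :
    (umbral f).comp (umbral g) = AlgHom.id ℚ SymFun := by
  refine algHom_ext_hFn fun n => ?_
  rw [AlgHom.comp_apply, umbral_hFn, map_sum, AlgHom.id_apply]
  have h (k : ℕ) (hk : k ∈ Finset.range (n + 1)) :
      umbral f (PowerSeries.coeff n (g ^ k) • hFn k) = ∑ j ∈ Finset.range (n + 1),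
        (PowerSeries.coeff k (f ^ j) * PowerSeries.coeff n (g ^ k)) • hFn j := by
    rw [map_smul, umbral_hFn, Finset.smul_sum]
    rw [Finset.mem_range] at hk
    refine Finset.sum_subset_zero_on_sdiff (fun j hj => ?_) (fun j hj => ?_) fun j _ => ?_
    · rw [Finset.mem_range] at hj ⊢
      omega
    · rw [Finset.mem_sdiff, Finset.mem_range, Finset.mem_range] at hj
      rw [coeff_pow_eq_zero_of_lt hf (by omega), zero_mul, zero_smul]
    · rw [smul_smul, mul_comm]
  rw [Finset.sum_congr rfl h, Finset.sum_comm]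
  simp only [← Finset.sum_smul, sum_coeff_pow_mul_coeff_pow hg hfg, ite_smul, one_smul, zero_smul]
  rw [Finset.sum_ite_eq (Finset.range (n + 1)), if_pos (by simp)]

theorem eq_of_sum_mul_eq {R : Type*} [CommRing R] [Algebra ℚ R] {a a' b : ℕ → R} (hb : b 0 = 1)
    (h : ∀ n, ∑ ij ∈ Finset.HasAntidiagonal.antidiagonal n, (-1 : ℚ) ^ ij.1 • (a ij.1 * b ij.2) =
      ∑ ij ∈ Finset.HasAntidiagonal.antidiagonal n, (-1 : ℚ) ^ ij.1 • (a' ij.1 * b ij.2)) (n : ℕ) :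
    a n = a' n := by
  induction n using Nat.strong_induction_on with
  | _ n ih =>
    have hn := h n
    rw [Finset.Nat.sum_antidiagonal_eq_sum_range_succ_mk,
      Finset.Nat.sum_antidiagonal_eq_sum_range_succ_mk, Finset.sum_range_succ,
      Finset.sum_range_succ, Finset.sum_congr rfl fun i hi => by rw [ih i (Finset.mem_range.1 hi)],
      add_right_inj, Nat.sub_self, hb, mul_one, mul_one] at hn
    have h2 := congrArg (fun x => (-1 : ℚ) ^ n • x) hn
    simpa only [smul_smul, ← mul_pow, neg_mul_neg, one_mul, one_pow, one_smul] using h2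

/-- `U_f` maps `e_n` to `c_n`, since the `c_n` satisfy with the `r_n` the relation that
determines the `e_n` in terms of the `h_n`. -/
theorem coe_umbral_eFn {f : ℚ⟦X⟧} (hf : PowerSeries.constantCoeff f = 0) (n : ℕ) :
    (umbral f (eFn n) : MvPowerSeries ℕ ℚ) = cFn f n := by
  let φ : SymFun →ₐ[ℚ] MvPowerSeries ℕ ℚ := SymFun.val.comp (umbral f)
  have hφ (n : ℕ) : φ (hFn n) = rFn f n := coe_umbral_hFn hf n
  refine eq_of_sum_mul_eq (a := fun n => φ (eFn n)) (a' := cFn f) (b := fun n => φ (hFn n)) ?_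
    (fun n => ?_) n
  · rw [hFn_zero, map_one]
  · have h1 := congrArg φ (sum_eFn_mul_hFn n)
    rw [map_sum] at h1
    simp only [map_smul, map_mul] at h1
    simp only [hφ] at h1 ⊢
    rw [h1, sum_cFn_mul_rFn]
    split_ifs
    · exact map_one φ
    · exact map_zero φ

theorem coe_umbral_schur {f : ℚ⟦X⟧} (hf : PowerSeries.constantCoeff f = 0) (lam : YoungDiagram) :
    (umbral f (schur lam) : MvPowerSeries ℕ ℚ) = rowDet (rFn f) lam := by
  have h := map_seqDet (SymFun.val.comp (umbral f)) hFn (lam.colLen 0) lam.rowLen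
  have h2 : (fun n => (SymFun.val.comp (umbral f)) (hFn n)) = rFn f :=
    funext fun n => coe_umbral_hFn hf n
  rw [h2] at h
  exact h

theorem coe_umbral_schur_dual {f : ℚ⟦X⟧} (hf : PowerSeries.constantCoeff f = 0)
    (lam : YoungDiagram) :
    (umbral f (schur lam) : MvPowerSeries ℕ ℚ) = rowDet (cFn f) lam.transpose := by
  have h := map_seqDet (SymFun.val.comp (umbral f)) eFn (lam.transpose.colLen 0)
    lam.transpose.rowLen
  have h2 : (fun n => (SymFun.val.comp (umbral f)) (eFn n)) = cFn f :=
    funext fun n => coe_umbral_eFn hf n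
  rw [h2] at h
  rw [schur_eq_rowDet_eFn]
  exact h

theorem colIterate_eq {Uf Ug : SymFun →ₐ[ℚ] SymFun} (h : Ug.comp Uf = AlgHom.id ℚ SymFun)
    (lam : YoungDiagram) : colIterate Uf Ug lam = Uf (schur lam) := by
  rw [schur_eq_foldr_colOp, colIterate]
  induction lam.transpose.rowLens with
  | nil => exact (map_one Uf).symm
  | cons m c ih =>
    rw [List.foldr_cons, List.foldr_cons, ih]
    congr 2
    exact DFunLike.congr_fun h _

/-! ### Sequences of convolution type -/

/-- The polynomial `[z^n] exp (x f(z))`. -/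
def umbralPoly (f : ℚ⟦X⟧) (n : ℕ) : ℚ[X] :=
  ∑ k ∈ Finset.range (n + 1), Polynomial.monomial k (PowerSeries.coeff n (f ^ k) / k.factorial)

theorem coeff_umbralPoly {f : ℚ⟦X⟧} (hf : PowerSeries.constantCoeff f = 0) (n k : ℕ) :
    (umbralPoly f n).coeff k = PowerSeries.coeff n (f ^ k) / k.factorial := by
  rw [umbralPoly]
  simp only [Polynomial.finsetSum_coeff, Polynomial.coeff_monomial]
  rw [Finset.sum_ite_eq' (Finset.range (n + 1)) k]
  split_ifs with h
  · rfl
  · rw [Finset.mem_range] at h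
    rw [coeff_pow_eq_zero_of_lt hf (by omega), zero_div]

theorem isDualToPowers_umbralPoly {f g : ℚ⟦X⟧} (hf : PowerSeries.constantCoeff f = 0)
    (hgf : g.subst f = (PowerSeries.X : ℚ⟦X⟧)) : IsDualToPowers g (umbralPoly f) := by
  intro k n
  have hsub : (umbralPoly f n).support ⊆ Finset.range (n + 1) := by
    intro j hj
    rw [Polynomial.mem_support_iff, coeff_umbralPoly hf] at hj
    by_contra H
    rw [Finset.mem_range] at H
    exact hj (by rw [coeff_pow_eq_zero_of_lt hf (by omega), zero_div])
  rw [umbralPairing, Polynomial.sum_eq_of_subset _ (fun _ => by simp) hsub]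
  have h := sum_coeff_pow_mul_coeff_pow hf hgf k n
  rw [if_congr (eq_comm (a := k)) rfl rfl, ← h]
  refine Finset.sum_congr rfl fun j _ => ?_
  rw [coeff_umbralPoly hf, mul_div_cancel₀ _ (by positivity)]

theorem isConvolutionType_umbralPoly {f : ℚ⟦X⟧} (hf : PowerSeries.constantCoeff f = 0) :
    IsConvolutionType (umbralPoly f) := by
  intro n
  ext a b
  have hl (k : ℕ) (r : ℚ) : (((Polynomial.aeval (Polynomial.X + Polynomial.C Polynomial.X :
      ℚ[X][X])) (Polynomial.monomial k r)).coeff a).coeff b =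
        if k = a + b then r * k.choose a else 0 := by
    rw [Polynomial.aeval_monomial, Polynomial.algebraMap_apply, Polynomial.algebraMap_apply,
      Polynomial.coeff_C_mul, Polynomial.coeff_C_mul, Polynomial.coeff_X_add_C_pow,
      ← Polynomial.C_eq_natCast, Polynomial.coeff_mul_C, Polynomial.coeff_X_pow]
    by_cases h1 : k = a + b
    · rw [if_pos h1, if_pos (by omega)]
      simp
    · rw [if_neg h1]
      by_cases h2 : k < a
      · rw [Nat.choose_eq_zero_of_lt h2]
        simp
      · rw [if_neg (by omega)]
        simp
  have hr (i j : ℕ) : (((umbralPoly f i).map (algebraMap ℚ ℚ[X]) *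
      Polynomial.C (umbralPoly f j)).coeff a).coeff b =
        PowerSeries.coeff i (f ^ a) * PowerSeries.coeff j (f ^ b) /
          (a.factorial * b.factorial) := by
    rw [Polynomial.coeff_mul_C, Polynomial.coeff_map, Polynomial.algebraMap_apply,
      Polynomial.coeff_C_mul, coeff_umbralPoly hf, coeff_umbralPoly hf,
      ← div_mul_div_comm]
    rfl
  have hsum : PowerSeries.coeff n (f ^ (a + b)) / (a + b).factorial * ((a + b).choose a : ℚ) =
      PowerSeries.coeff n (f ^ (a + b)) / (a.factorial * b.factorial) := by
    rw [Nat.cast_add_choose]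
    have := Nat.factorial_ne_zero (a + b)
    field_simp
  conv_lhs => rw [umbralPoly]
  simp only [map_sum, Polynomial.finsetSum_coeff, hl, hr]
  rw [Finset.sum_ite_eq' (Finset.range (n + 1)) (a + b), ← Finset.sum_div, ← PowerSeries.coeff_mul,
    ← pow_add, hsum]
  split_ifs with h
  · rfl
  · rw [Finset.mem_range] at h
    rw [coeff_pow_eq_zero_of_lt hf (by omega), zero_div]

theorem polyEmbed_umbralPoly (f : ℚ⟦X⟧) (n : ℕ) :
    polyEmbed (umbralPoly f n) = umbral f (hFn n) := by
  rw [umbral_hFn, umbralPoly, map_sum]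
  refine Finset.sum_congr rfl fun k _ => ?_
  rw [polyEmbed, Polynomial.lsum_apply, Polynomial.sum_monomial_index _ _ (by simp),
    LinearMap.toSpanSingleton_apply, smul_smul, div_mul_cancel₀ _ (by positivity)]

/-! ### Adjoints and dual bases -/

theorem hProd_mapDomain (σ : Equiv.Perm ℕ) (d : ℕ →₀ ℕ) : hProd (d.mapDomain σ) = hProd d :=
  Finsupp.prod_mapDomain_index_inj σ.injective

/-- The adjoint of an operator on `Λ` for the Hall pairing. -/
def adjointSeries (U : SymFun →ₐ[ℚ] SymFun) : SymSeries →ₗ[ℚ] SymSeries where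
  toFun w := ⟨(fun d => hallPairing w (U (hProd d)) : (ℕ →₀ ℕ) → ℚ),
    mem_symSeries_of_coeff fun σ d => by
      change hallPairing w (U (hProd (d.mapDomain σ))) = hallPairing w (U (hProd d))
      rw [hProd_mapDomain]⟩
  map_add' v w := by
    refine Subtype.ext (MvPowerSeries.ext fun d => ?_)
    change hallPairing (v + w) (U (hProd d)) =
      hallPairing v (U (hProd d)) + hallPairing w (U (hProd d))
    rw [map_add, LinearMap.add_apply]
  map_smul' r w := by
    refine Subtype.ext (MvPowerSeries.ext fun d => ?_)
    change hallPairing (r • w) (U (hProd d)) = r * hallPairing w (U (hProd d))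
    rw [map_smul, LinearMap.smul_apply, smul_eq_mul]

theorem hallPairing_adjointSeries (U : SymFun →ₐ[ℚ] SymFun) (w : SymSeries) (p : SymFun) :
    hallPairing (adjointSeries U w) p = hallPairing w (U p) := by
  have h : hallPairing (adjointSeries U w) = (hallPairing w).comp U.toLinearMap :=
    linearMap_ext_hProd fun d => by rw [hallPairing_hProd]; rfl
  exact LinearMap.congr_fun h p

theorem symSeries_ext {v w : SymSeries} (h : hallPairing v = hallPairing w) : v = w := by
  refine Subtype.ext (MvPowerSeries.ext fun d => ?_)
  rw [← hallPairing_hProd, h, hallPairing_hProd]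

theorem isAdjoint_iff (U : SymFun →ₐ[ℚ] SymFun) (S : SymSeries →ₗ[ℚ] SymSeries) :
    IsAdjoint hallPairing U S ↔ S = adjointSeries U := by
  refine ⟨fun h => LinearMap.ext fun w => symSeries_ext (LinearMap.ext fun p => ?_), ?_⟩
  · rw [h, hallPairing_adjointSeries]
  · rintro rfl
    exact hallPairing_adjointSeries U

theorem hallPairing_eq_coord {P : Module.Basis YoungDiagram ℚ SymFun} {Q : YoungDiagram → SymSeries}
    (h : IsDualFamily hallPairing Q P) (mu : YoungDiagram) : hallPairing (Q mu) = P.coord mu := by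
  classical
  refine P.ext fun lam => ?_
  rw [h, Module.Basis.coord_apply, Module.Basis.repr_self, Finsupp.single_apply]
  exact if_congr eq_comm rfl rfl

theorem isDualFamily_unique {P : Module.Basis YoungDiagram ℚ SymFun} {Q : YoungDiagram → SymSeries}
    (h : IsDualFamily hallPairing Q P) (Q' : YoungDiagram → SymSeries) :
    IsDualFamily hallPairing Q' P ↔ ∀ mu, Q' mu = Q mu := by
  refine ⟨fun h' mu => symSeries_ext ?_, fun h' => ?_⟩
  · rw [hallPairing_eq_coord h, hallPairing_eq_coord h']
  · rwa [funext h']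

/-- The family dual to a basis of `Λ` is a basis of `Λ*` in the sense of infinite combinations:
the coefficients of `w` with respect to it are the values of `⟨w, ·⟩` on the basis of `Λ`. -/
theorem isSeriesBasis_of_isDualFamily {P : Module.Basis YoungDiagram ℚ SymFun}
    {Q : YoungDiagram → SymSeries} (h : IsDualFamily hallPairing Q P) : IsSeriesBasis Q := by
  have hcoeff (lam : YoungDiagram) (d : ℕ →₀ ℕ) :
      MvPowerSeries.coeff d (Q lam : MvPowerSeries ℕ ℚ) = P.repr (hProd d) lam := by
    rw [← hallPairing_hProd, hallPairing_eq_coord h, Module.Basis.coord_apply]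
  have hsum (a : YoungDiagram → ℚ) (d : ℕ →₀ ℕ) :
      ∑ᶠ lam, a lam * MvPowerSeries.coeff d (Q lam : MvPowerSeries ℕ ℚ) =
        P.constr ℚ a (hProd d) := by
    rw [Module.Basis.constr_apply, Finsupp.sum,
      finsum_eq_sum_of_support_subset (s := (P.repr (hProd d)).support)]
    · refine Finset.sum_congr rfl fun lam _ => ?_
      rw [hcoeff, smul_eq_mul, mul_comm]
    · intro lam hlam
      rw [Finset.mem_coe, Finsupp.mem_support_iff, ← hcoeff]
      exact right_ne_zero_of_mul hlam
  refine ⟨fun d => ?_, fun w => ⟨fun lam => hallPairing w (P lam), fun d => ?_, fun a ha => ?_⟩⟩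
  · refine (P.repr (hProd d)).support.finite_toSet.subset fun lam hlam => ?_
    rw [Finset.mem_coe, Finsupp.mem_support_iff, ← hcoeff]
    exact hlam
  · have h1 : P.constr ℚ (fun lam => hallPairing w (P lam)) = hallPairing w :=
      P.ext fun lam => P.constr_basis ℚ _ lam
    rw [hsum, h1, hallPairing_hProd]
  · have h1 : hallPairing w = P.constr ℚ a :=
      linearMap_ext_hProd fun d => by rw [hallPairing_hProd, ha, hsum]
    funext lam
    rw [h1, P.constr_basis]

/-! ### The coproduct and the Littlewood–Richardson rule for it -/

open scoped TensorProduct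

/-- The coproduct of `Λ`, with `Δ h_n = ∑_k h_k ⊗ h_{n-k}`. -/
def coproduct : SymFun →ₐ[ℚ] SymFun ⊗[ℚ] SymFun :=
  hLift fun n => ∑ ij ∈ Finset.HasAntidiagonal.antidiagonal n, hFn ij.1 ⊗ₜ[ℚ] hFn ij.2

theorem coproduct_hFn (n : ℕ) : coproduct (hFn n) =
    ∑ ij ∈ Finset.HasAntidiagonal.antidiagonal n, hFn ij.1 ⊗ₜ[ℚ] hFn ij.2 := by
  refine hLift_hFn (b := fun n => ∑ ij ∈ Finset.HasAntidiagonal.antidiagonal n,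
    hFn ij.1 ⊗ₜ[ℚ] hFn ij.2) ?_ n
  simp only [Finset.Nat.antidiagonal_zero, Finset.sum_singleton, hFn_zero]
  rfl

theorem consComp_induction {C : (ℕ →₀ ℕ) → Prop} (zero : C 0)
    (cons : ∀ n d, C d → C (consComp n d)) (d : ℕ →₀ ℕ) : C d := by
  have h (N : ℕ) : ∀ d : ℕ →₀ ℕ, (∀ i, N ≤ i → d i = 0) → C d := by
    induction N with
    | zero =>
      intro d hd
      have : d = 0 := Finsupp.ext fun i => hd i (Nat.zero_le i)
      rwa [this]
    | succ N ih =>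
      intro d hd
      rw [← consComp_eta d]
      refine cons _ _ (ih _ fun i hi => ?_)
      rw [Finsupp.comapDomain_apply]
      exact hd _ (Nat.succ_le_succ hi)
  refine h (d.degree + d.support.sup id + 1) d fun i hi => ?_
  by_contra H
  have : i ≤ d.support.sup id := Finset.le_sup (f := id) (Finsupp.mem_support_iff.2 H)
  omega

theorem hProd_zero : hProd 0 = 1 := Finsupp.prod_zero_index

theorem hProd_consComp (n : ℕ) (d : ℕ →₀ ℕ) : hProd (consComp n d) = hFn n * hProd d :=
  prod_consComp hFn hFn_zero n d

theorem coproduct_hProd (d : ℕ →₀ ℕ) : coproduct (hProd d) =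
    ∑ x ∈ Finset.HasAntidiagonal.antidiagonal d, hProd x.1 ⊗ₜ[ℚ] hProd x.2 := by
  induction d using consComp_induction with
  | zero =>
    rw [hProd_zero, map_one, Finsupp.antidiagonal_zero, Finset.sum_singleton, hProd_zero]
    rfl
  | cons n d ih =>
    rw [hProd_consComp, map_mul, ih, coproduct_hFn, Finset.sum_mul_sum, sum_antidiagonal_consComp]
    refine Finset.sum_congr rfl fun ij _ => Finset.sum_congr rfl fun x _ => ?_
    rw [Algebra.TensorProduct.tmul_mul_tmul, hProd_consComp, hProd_consComp]

/-- The product of `Λ*` is dual to the coproduct of `Λ`. -/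
theorem hallPairing_mul (v w : SymSeries) (p : SymFun) : hallPairing (v * w) p =
    LinearMap.mul' ℚ ℚ (TensorProduct.map (hallPairing v) (hallPairing w) (coproduct p)) := by
  classical
  have h : hallPairing (v * w) = (LinearMap.mul' ℚ ℚ).comp
      ((TensorProduct.map (hallPairing v) (hallPairing w)).comp coproduct.toLinearMap) := by
    refine linearMap_ext_hProd fun d => ?_
    rw [hallPairing_hProd, MulMemClass.coe_mul, MvPowerSeries.coeff_mul, LinearMap.comp_apply,
      LinearMap.comp_apply, AlgHom.toLinearMap_apply, coproduct_hProd, map_sum, map_sum]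
    refine Finset.sum_congr rfl fun x _ => ?_
    rw [TensorProduct.map_tmul, LinearMap.mul'_apply, hallPairing_hProd, hallPairing_hProd]
  exact LinearMap.congr_fun h p

theorem hallPairing_toSeries_schur (p : SymFun) (lam : YoungDiagram) :
    hallPairing (toSeries p) (schur lam) = schurBasis.repr p lam := by
  classical
  have h : (hallPairing.flip (schur lam)).comp toSeries.toLinearMap = schurBasis.coord lam := by
    refine schurBasis.ext fun mu => ?_
    rw [LinearMap.comp_apply, LinearMap.flip_apply, AlgHom.toLinearMap_apply,
      Module.Basis.coord_apply, Module.Basis.repr_self, Finsupp.single_apply, schurBasis_apply,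
      hallPairing_schur]
  exact LinearMap.congr_fun h p

/-- The Littlewood–Richardson coefficients `c^λ_{μν}`, as a family in `λ`. -/
def lrCoeff (mu nu : YoungDiagram) : YoungDiagram →₀ ℚ := schurBasis.repr (schur mu * schur nu)

theorem isLRCoeff_iff (c : YoungDiagram → YoungDiagram → YoungDiagram →₀ ℚ) :
    IsLRCoeff c ↔ c = lrCoeff := by
  have h (a : YoungDiagram →₀ ℚ) : (a.sum fun lam r => r • schur lam) = schurBasis.repr.symm a := by
    rw [Module.Basis.repr_symm_apply, Finsupp.linearCombination_apply]
    simp only [schurBasis_apply]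
  refine ⟨fun hc => funext fun mu => funext fun nu => ?_, ?_⟩
  · rw [lrCoeff, hc mu nu, h, LinearEquiv.apply_symm_apply]
  · rintro rfl mu nu
    rw [h, lrCoeff, LinearEquiv.symm_apply_apply]

/-- The coordinates of `Δ s_λ` are the Littlewood–Richardson coefficients, by duality. -/
theorem repr_coproduct_schur (lam : YoungDiagram) (x : YoungDiagram × YoungDiagram) :
    (schurBasis.tensorProduct schurBasis).repr (coproduct (schur lam)) x =
      lrCoeff x.1 x.2 lam := by
  classical
  obtain ⟨mu, nu⟩ := x
  have h : (schurBasis.tensorProduct schurBasis).coord (mu, nu) = (LinearMap.mul' ℚ ℚ).comp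
      (TensorProduct.map (hallPairing (toSeries (schur mu)))
        (hallPairing (toSeries (schur nu)))) := by
    refine (schurBasis.tensorProduct schurBasis).ext fun y => ?_
    obtain ⟨mu', nu'⟩ := y
    rw [Module.Basis.coord_apply, Module.Basis.repr_self, Finsupp.single_apply,
      Module.Basis.tensorProduct_apply, LinearMap.comp_apply, TensorProduct.map_tmul,
      LinearMap.mul'_apply, schurBasis_apply, schurBasis_apply, hallPairing_schur,
      hallPairing_schur]
    by_cases h1 : mu = mu' <;> by_cases h2 : nu = nu' <;> simp [h1, h2, eq_comm]
  rw [← Module.Basis.coord_apply, h, lrCoeff, ← hallPairing_toSeries_schur, map_mul,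
    hallPairing_mul]
  rfl

/-! ### Disjoint alphabets -/

theorem coeff_plethAdd (p : SymFun) (d : ℕ ⊕ ℕ →₀ ℕ) : MvPowerSeries.coeff d (plethAdd p) =
    MvPowerSeries.coeff (d.mapDomain Equiv.natSumNatEquivNat) (p : MvPowerSeries ℕ ℚ) := by
  have h := MvPowerSeries.coeff_embDomain_rename (R := ℚ)
    Equiv.natSumNatEquivNat.symm.toEmbedding (p : MvPowerSeries ℕ ℚ)
    (d.mapDomain Equiv.natSumNatEquivNat)
  rw [Finsupp.embDomain_eq_mapDomain, ← Finsupp.mapDomain_comp] at h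
  have h2 : (Equiv.natSumNatEquivNat.symm.toEmbedding : ℕ → ℕ ⊕ ℕ) ∘ Equiv.natSumNatEquivNat =
      id := by
    funext x
    exact Equiv.symm_apply_apply _ x
  rw [h2, Finsupp.mapDomain_id] at h
  exact h

theorem embDomain_inl_add_embDomain_inr (a b : ℕ →₀ ℕ) :
    a.embDomain (Function.Embedding.inl : ℕ ↪ ℕ ⊕ ℕ) + b.embDomain Function.Embedding.inr =
      Finsupp.sumElim a b := by
  rw [Finsupp.embDomain_eq_mapDomain, Finsupp.embDomain_eq_mapDomain]
  exact (Finsupp.sumElim_eq_add a b).symm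

theorem coeff_outer (p q : SymFun) (d : ℕ ⊕ ℕ →₀ ℕ) : MvPowerSeries.coeff d (outer p q) =
    MvPowerSeries.coeff (Finsupp.sumFinsuppEquivProdFinsupp d).1 (p : MvPowerSeries ℕ ℚ) *
      MvPowerSeries.coeff (Finsupp.sumFinsuppEquivProdFinsupp d).2 (q : MvPowerSeries ℕ ℚ) := by
  classical
  have hl := MvPowerSeries.coeff_embDomain_rename (R := ℚ) (Function.Embedding.inl : ℕ ↪ ℕ ⊕ ℕ)
    (p : MvPowerSeries ℕ ℚ)
  have hr := MvPowerSeries.coeff_embDomain_rename (R := ℚ) (Function.Embedding.inr : ℕ ↪ ℕ ⊕ ℕ)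
    (q : MvPowerSeries ℕ ℚ)
  obtain ⟨⟨a, b⟩, rfl⟩ := Finsupp.sumFinsuppEquivProdFinsupp.symm.surjective d
  rw [Equiv.apply_symm_apply]
  have hd' : Finsupp.sumFinsuppEquivProdFinsupp.symm (a, b) = Finsupp.sumElim a b := rfl
  rw [hd', ← embDomain_inl_add_embDomain_inr, outer, MvPowerSeries.coeff_mul, Finset.sum_eq_single
    (a.embDomain Function.Embedding.inl, b.embDomain Function.Embedding.inr), hl, hr]
  · rintro ⟨x, y⟩ hxy hne
    rw [Finset.HasAntidiagonal.mem_antidiagonal] at hxy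
    by_cases hx : x ∈ Set.range (Finsupp.mapDomain (M := ℕ) (Function.Embedding.inl : ℕ ↪ ℕ ⊕ ℕ))
    · by_cases hy : y ∈ Set.range
        (Finsupp.mapDomain (M := ℕ) (Function.Embedding.inr : ℕ ↪ ℕ ⊕ ℕ))
      · obtain ⟨x, rfl⟩ := hx
        obtain ⟨y, rfl⟩ := hy
        rw [← Finsupp.embDomain_eq_mapDomain, ← Finsupp.embDomain_eq_mapDomain] at hxy hne
        dsimp only at hxy
        rw [embDomain_inl_add_embDomain_inr, embDomain_inl_add_embDomain_inr] at hxy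
        obtain ⟨rfl, rfl⟩ := Prod.mk.inj (Finsupp.sumFinsuppEquivProdFinsupp.symm.injective
          (a₁ := (x, y)) (a₂ := (a, b)) hxy)
        exact absurd rfl hne
      · exact mul_eq_zero_of_right _ (MvPowerSeries.coeff_rename_eq_zero
          (Function.Embedding.inr : ℕ ↪ ℕ ⊕ ℕ) (q : MvPowerSeries ℕ ℚ) hy)
    · exact mul_eq_zero_of_left (MvPowerSeries.coeff_rename_eq_zero
        (Function.Embedding.inl : ℕ ↪ ℕ ⊕ ℕ) (p : MvPowerSeries ℕ ℚ) hx) _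
  · intro H
    exact (H (by rw [Finset.HasAntidiagonal.mem_antidiagonal])).elim

/-- The map `p ⊗ q ↦ p(X) q(X')`. -/
def outerHom : SymFun ⊗[ℚ] SymFun →ₐ[ℚ] MvPowerSeries (ℕ ⊕ ℕ) ℚ :=
  Algebra.TensorProduct.productMap
    ((MvPowerSeries.rename (Function.Embedding.inl : ℕ ↪ ℕ ⊕ ℕ)).comp SymFun.val)
    ((MvPowerSeries.rename (Function.Embedding.inr : ℕ ↪ ℕ ⊕ ℕ)).comp SymFun.val)

theorem outerHom_tmul (p q : SymFun) : outerHom (p ⊗ₜ[ℚ] q) = outer p q :=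
  Algebra.TensorProduct.productMap_apply_tmul _ _ _ _

/-- `r_n(X + X') = ∑_k r_k(X) r_{n-k}(X')`. -/
theorem plethAdd_umbral_hFn {f : ℚ⟦X⟧} (hf : PowerSeries.constantCoeff f = 0) (n : ℕ) :
    plethAdd (umbral f (hFn n)) = ∑ ij ∈ Finset.HasAntidiagonal.antidiagonal n,
      outer (umbral f (hFn ij.1)) (umbral f (hFn ij.2)) := by
  ext d
  have hdeg : d.degree = (Finsupp.sumFinsuppEquivProdFinsupp d).1.degree +
      (Finsupp.sumFinsuppEquivProdFinsupp d).2.degree := by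
    obtain ⟨⟨a, b⟩, rfl⟩ := Finsupp.sumFinsuppEquivProdFinsupp.symm.surjective d
    rw [Equiv.apply_symm_apply]
    have hd : Finsupp.sumFinsuppEquivProdFinsupp.symm (a, b) = Finsupp.sumElim a b := rfl
    rw [hd, ← embDomain_inl_add_embDomain_inr, map_add, Finsupp.embDomain_eq_mapDomain,
      Finsupp.embDomain_eq_mapDomain, Finsupp.degree_mapDomain, Finsupp.degree_mapDomain]
  rw [coeff_plethAdd, coe_umbral_hFn hf, coeff_rFn, Finsupp.degree_mapDomain, hdeg, pow_add,
    PowerSeries.coeff_mul, map_sum]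
  refine Finset.sum_congr rfl fun ij _ => ?_
  rw [coeff_outer, coe_umbral_hFn hf, coe_umbral_hFn hf, coeff_rFn, coeff_rFn]

/-- `U_f` commutes with the coproduct. -/
theorem plethAdd_umbral {f : ℚ⟦X⟧} (hf : PowerSeries.constantCoeff f = 0) (p : SymFun) :
    plethAdd (umbral f p) =
      outerHom (Algebra.TensorProduct.map (umbral f) (umbral f) (coproduct p)) := by
  have h : ((MvPowerSeries.rename Equiv.natSumNatEquivNat.symm).comp SymFun.val).comp (umbral f) =
      (outerHom.comp (Algebra.TensorProduct.map (umbral f) (umbral f))).comp coproduct := by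
    refine algHom_ext_hFn fun n => ?_
    refine (plethAdd_umbral_hFn hf n).trans ?_
    rw [AlgHom.comp_apply, coproduct_hFn, map_sum]
    refine Finset.sum_congr rfl fun ij _ => ?_
    rw [AlgHom.comp_apply, Algebra.TensorProduct.map_tmul, outerHom_tmul]
  exact DFunLike.congr_fun h p

theorem finite_lrCoeff_ne_zero (lam : YoungDiagram) :
    {x : YoungDiagram × YoungDiagram | lrCoeff x.1 x.2 lam ≠ 0}.Finite := by
  refine ((schurBasis.tensorProduct schurBasis).repr
    (coproduct (schur lam))).support.finite_toSet.subset fun x hx => ?_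
  rw [Finset.mem_coe, Finsupp.mem_support_iff, repr_coproduct_schur]
  exact hx

theorem plethAdd_umbral_schur {f : ℚ⟦X⟧} (hf : PowerSeries.constantCoeff f = 0)
    (lam : YoungDiagram) : plethAdd (umbral f (schur lam)) =
      ∑ᶠ x : YoungDiagram × YoungDiagram,
        lrCoeff x.1 x.2 lam • outer (umbral f (schur x.1)) (umbral f (schur x.2)) := by
  have h := (schurBasis.tensorProduct schurBasis).linearCombination_repr (coproduct (schur lam))
  rw [Finsupp.linearCombination_apply, Finsupp.sum] at h
  rw [plethAdd_umbral hf, ← h, map_sum, map_sum, finsum_eq_sum_of_support_subset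
    (s := ((schurBasis.tensorProduct schurBasis).repr (coproduct (schur lam))).support)]
  · refine Finset.sum_congr rfl fun x _ => ?_
    rw [map_smul, map_smul, repr_coproduct_schur, Module.Basis.tensorProduct_apply',
      Algebra.TensorProduct.map_tmul, outerHom_tmul, schurBasis_apply, schurBasis_apply]
  · intro x hx
    rw [Finset.mem_coe, Finsupp.mem_support_iff, repr_coproduct_schur]
    intro H
    rw [Function.mem_support, H, zero_smul] at hx
    exact hx rfl

end SymLR

end

open SymLR

theorem mainTheorem2 (f g : PowerSeries ℚ) (hfg : IsDeltaPair f g) :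
    ∃ (hall : SymSeries →ₗ[ℚ] SymFun →ₗ[ℚ] ℚ)
      (lr : YoungDiagram → YoungDiagram → YoungDiagram →₀ ℚ)
      (Uf Ug : SymFun →ₐ[ℚ] SymFun) (UgStar : SymSeries →ₗ[ℚ] SymSeries)
      (P : Module.Basis YoungDiagram ℚ SymFun),
      (∀ B, IsHallPairing B ↔ B = hall) ∧
      (∀ a, IsLRCoeff a ↔ a = lr) ∧
      (∀ U, IsUmbral f U ↔ U = Uf) ∧
      (∀ U, IsUmbral g U ↔ U = Ug) ∧
      (∀ S, IsAdjoint hall Ug S ↔ S = UgStar) ∧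
      (Uf.comp Ug = AlgHom.id ℚ SymFun ∧ Ug.comp Uf = AlgHom.id ℚ SymFun) ∧
      (∃ p : ℕ → Polynomial ℚ, IsDualToPowers g p ∧ IsConvolutionType p ∧
        ∀ n, (polyEmbed (p n) : MvPowerSeries ℕ ℚ) = rFn f n) ∧
      (∀ lam, (P lam : MvPowerSeries ℕ ℚ) = rowDet (rFn f) lam) ∧
      (∀ lam, P lam = Uf (schur lam)) ∧
      (∀ lam, P lam = colIterate Uf Ug lam) ∧
      (∀ lam, {x : YoungDiagram × YoungDiagram | lr x.1 x.2 lam ≠ 0}.Finite ∧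
        plethAdd (P lam) =
          ∑ᶠ x : YoungDiagram × YoungDiagram, lr x.1 x.2 lam • outer (P x.1) (P x.2)) ∧
      (∀ Q : YoungDiagram → SymSeries,
        IsDualFamily hall Q P ↔ ∀ mu, Q mu = UgStar (toSeries (schur mu))) ∧
      IsSeriesBasis (fun mu => UgStar (toSeries (schur mu))) ∧
      (∀ lam, (P lam : MvPowerSeries ℕ ℚ) = rowDet (cFn f) lam.transpose) := by
  obtain ⟨hf, hg, hr, hl⟩ := hfg
  have hUV := umbral_comp_umbral hf hg hr
  have hVU := umbral_comp_umbral hg hf hl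
  let P := schurBasis.map (AlgEquiv.ofAlgHom (umbral f) (umbral g) hUV hVU).toLinearEquiv
  have hP (lam : YoungDiagram) : P lam = umbral f (schur lam) := by
    rw [Module.Basis.map_apply, schurBasis_apply]
    rfl
  have hdual : IsDualFamily hallPairing
      (fun mu => adjointSeries (umbral g) (toSeries (schur mu))) P := by
    classical
    intro mu lam
    rw [hallPairing_adjointSeries, hP]
    have h : umbral g (umbral f (schur lam)) = schur lam := DFunLike.congr_fun hVU _
    rw [h, hallPairing_schur]
  refine ⟨hallPairing, lrCoeff, umbral f, umbral g, adjointSeries (umbral g), P, isHallPairing_iff,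
    isLRCoeff_iff, isUmbral_iff hf, isUmbral_iff hg, isAdjoint_iff _, ⟨hUV, hVU⟩,
    ⟨umbralPoly f, isDualToPowers_umbralPoly hf hl, isConvolutionType_umbralPoly hf, fun n => ?_⟩,
    fun lam => ?_, hP, fun lam => ?_, fun lam => ⟨finite_lrCoeff_ne_zero lam, ?_⟩,
    isDualFamily_unique hdual, isSeriesBasis_of_isDualFamily hdual, fun lam => ?_⟩
  · rw [polyEmbed_umbralPoly, coe_umbral_hFn hf]
  · rw [hP, coe_umbral_schur hf]
  · rw [hP, colIterate_eq hVU]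
  · simp only [hP]
    exact plethAdd_umbral_schur hf lam
  · rw [hP, coe_umbral_schur_dual hf]
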